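/- **Notation.** Let $d\ge 1$ be an integer. Tensors of order $k$ over $\mathbb R^d$ are arrays $A=(A_{i_1,\dots,i_k})$ with the Frobenius inner product; $\mathrm{Sym}(A)=\frac1{k!}\sum_{\sigma\in\mathfrak S_k}A^\sigma$ is the symmetrization; $I$ is the identity matrix, viewed as a tensor of order $2$. A symmetric tensor is traceless if $\sum_{s=1}^d A_{s,s,i_1,\dots,i_{k-2}}=0$ for all $i_1,\dots,i_{k-2}$ (no condition if $k\le 1$), and $P_{\mathrm{tf}}$ is the orthogonal projection onto traceless symmetric tensors. Write $(a)_n=a(a+1)\cdots(a+n-1)$. Let $N_{d,\ell}$ be the dimension of the space of spherical harmonics of degree $\ell$ on the unit sphere $\mathbb S^{d-1}$, and $$\kappa_{d,\ell}=\sqrt{2^\ell\,\frac{(d/2-1)_\ell}{(d-2)_\ell}},\qquad \mathcal H_{d,\ell}(z)=\kappa_{d,\ell}\sqrt{N_{d,\ell}}\;P_{\mathrm{tf}}(z^{\otimes \ell})\quad(z\in\mathbb S^{d-1}).$$ For $d=2$, $\ell\ge 1$ the quotient $0/0$ is understood by continuity in $d$, that is $\kappa_{2,\ell}=\sqrt{2^{\ell-1}}$.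 For $d=1$, $\ell\ge 2$ one has $N_{1,\ell}=0$ and $\mathcal H_{1,\ell}=0$, and the coefficients $\beta^{(1)}_{k,\ell}$ below are set to $0$. With $\gamma_d(x)=(2\pi)^{-d/2}e^{-\|x\|_2^2/2}$, the Hermite tensor is $\mathrm{He}_k(x)=\frac{(-1)^k}{\sqrt{k!}}\frac{\nabla^k\gamma_d(x)}{\gamma_d(x)}$. For $0\le 2j\le k$ put $$f^{(d)}_{\ell,j}=\frac{\ell!}{2^{2j}\,j!\,(\ell-2j)!\,(d/2+\ell-2j)_j},\qquad \beta^{(d)}_{k,k-2j}(r)=\frac{\sqrt{k!}}{\kappa_{d,k-2j}\sqrt{N_{d,k-2j}}}\sum_{i=0}^{j}\frac{(-1)^i r^{k-2i}}{2^i\,i!\,(k-2i)!}\,f^{(d)}_{k-2i,j-i}.$$ **Lemma (Hermite-to-harmonic decomposition).** 1. For all integers $d\ge1$, $k\ge0$ and every $x\in\mathbb R^d$, writing $x=rz$ with $r=\|x\|_2$ and $z\in\mathbb S^{d-1}$ (so $z=x/\|x\|_2$ if $x\ne0$, and $z$ is arbitrary if $x=0$), $$\mathrm{He}_k(x)=\sum_{j=0}^{\lfloor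 k/2\rfloor}\beta^{(d)}_{k,k-2j}(r)\;\mathrm{Sym}\bigl(\mathcal H_{d,k-2j}(z)\otimes I^{\otimes j}\bigr).$$ 2. For all $d\ge1$ and $\ell,j\ge0$, $$\beta^{(d)}_{\ell+2j,\ell}(r)=\frac{(-1)^j\sqrt{(\ell+2j)!}}{2^j\,\kappa_{d,\ell}\sqrt{N_{d,\ell}}\;\ell!\,(d/2+\ell)_j}\;r^\ell\,L_j^{(d/2+\ell-1)}\!\left(\frac{r^2}{2}\right),$$ where $L_j^{(\alpha)}(x)=\sum_{t=0}^{j}(-1)^t\binom{j+\alpha}{j-t}\frac{x^t}{t!}$ is the generalized Laguerre polynomial. 3. Let $r\sim\chi_d$ (the law of the norm of a standard Gaussian vector in $\mathbb R^d$). The first and second moments of $\beta^{(d)}_{\ell+2j,\ell}(r)$ are finite and, for fixed integers $\ell,j\ge0$, as $d\to\infty$, $$\mathbb E\bigl[\beta^{(d)}_{\ell+2j,\ell}(r)^2\bigr]=\Theta(d^{-j}),\qquad \mathbb E\bigl[\beta^{(d)}_{\ell+2j,\ell}(r)\bigr]^2=\Theta(d^{-2j})\quad\text{if } \ell\ge1\text{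 or }j=0,$$ while $\mathbb E[\beta^{(d)}_{2j,0}(r)]=0$ for all $d,j\ge1$. 4. For every integer $\ell\ge0$ there is a constant $C>0$ (depending on $\ell$) such that for all $d,j\ge C$, $$\frac{\mathbb E[\beta^{(d)}_{\ell+2(j+1),\ell}(r)^2]}{\mathbb E[\beta^{(d)}_{\ell+2j,\ell}(r)^2]}\le1,\qquad\text{and, if }\ell\ge1,\qquad \frac{\mathbb E[\beta^{(d)}_{\ell+2(j+1),\ell}(r)]^2}{\mathbb E[\beta^{(d)}_{\ell+2j,\ell}(r)]^2}\le1,$$ with positive denominators. -/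

import Mathlib

open scoped BigOperators Nat

noncomputable section

namespace HermiteHarmonic

/-- `ℝ^d` with its Euclidean norm. -/
abbrev Vec (d : ℕ) : Type := EuclideanSpace ℝ (Fin d)

/-- Tensors of order `k` over `ℝ^d`, as arrays of entries indexed by `i : Fin k → Fin d`; the
inner product is the Frobenius inner product. -/
abbrev Tensor (d k : ℕ) : Type := EuclideanSpace ℝ (Fin k → Fin d)

/-! ### Tensor operations -/

/-- The rising factorial `(a)_n = a (a + 1) ⋯ (a + n - 1)`. -/
def rising (a : ℝ) (n : ℕ) : ℝ := (ascPochhammer ℝ n).eval a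

/-- Transport of a tensor along an equality of orders. -/
def castOrder {d m n : ℕ} (h : m = n) (A : Tensor d m) : Tensor d n :=
  WithLp.toLp 2 fun i => A fun a => i (Fin.cast h a)

/-- The tensor product: the first `p` indices go to `A` and the last `q` indices to `B`. -/
def tmul {d p q : ℕ} (A : Tensor d p) (B : Tensor d q) : Tensor d (p + q) :=
  WithLp.toLp 2 fun i => A (fun a => i (Fin.castAdd q a)) * B (fun b => i (Fin.natAdd p b))

/-- The power `x^{⊗ k}` of a vector. -/
def vecPow {d : ℕ} (x : Vec d) (k : ℕ) : Tensor d k :=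
  WithLp.toLp 2 fun i => ∏ a, x (i a)

/-- The power `I_d^{⊗ j}` of the identity matrix, a tensor of order `2 j`: indices `2 m` and
`2 m + 1` are paired. -/
def idPow (d j : ℕ) : Tensor d (2 * j) :=
  WithLp.toLp 2 fun i => ∏ m : Fin j,
    if i ⟨2 * (m : ℕ), by omega⟩ = i ⟨2 * (m : ℕ) + 1, by omega⟩ then (1 : ℝ) else 0

/-- Symmetrization, the average over all permutations of the indices. -/
def symProj {d k : ℕ} (A : Tensor d k) : Tensor d k :=
  WithLp.toLp 2 fun i => (1 / (k ! : ℝ)) * ∑ σ : Equiv.Perm (Fin k), A (fun a => i (σ a))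

/-- The subspace of symmetric tensors. -/
def symTensors (d k : ℕ) : Submodule ℝ (Tensor d k) where
  carrier := {A | ∀ (σ : Equiv.Perm (Fin k)) (i : Fin k → Fin d), A (fun a => i (σ a)) = A i}
  zero_mem' := by intro σ i; rfl
  add_mem' := by
    intro A B hA hB σ i
    simp only [PiLp.add_apply, hA σ i, hB σ i]
  smul_mem' := by
    intro c A hA σ i
    simp only [PiLp.smul_apply, hA σ i]

/-- The partial trace over the first two indices. -/
def partialTrace (d k : ℕ) : Tensor d (k + 2) →ₗ[ℝ] Tensor d k where
  toFun A := WithLp.toLp 2 fun i => ∑ s : Fin d, A (Fin.cons s (Fin.cons s i))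
  map_add' A B := by
    ext i
    simp [Finset.sum_add_distrib]
  map_smul' c A := by
    ext i
    simp [Finset.mul_sum]

/-- The subspace of traceless symmetric tensors; for orders `0` and `1` there is no trace to take
and all tensors belong to it. -/
def tracelessSym (d : ℕ) : (k : ℕ) → Submodule ℝ (Tensor d k)
  | 0 => symTensors d 0
  | 1 => symTensors d 1
  | k + 2 => symTensors d (k + 2) ⊓ LinearMap.ker (partialTrace d k)

/-- The orthogonal projection (for the Frobenius inner product) onto traceless symmetric
tensors. -/
def tfProj {d k : ℕ} (A : Tensor d k) : Tensor d k :=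
  (tracelessSym d k).starProjection A

/-! ### Spherical harmonics and harmonic tensors -/

/-- The unit sphere of `ℝ^d`. -/
abbrev UnitSphere (d : ℕ) : Type := Metric.sphere (0 : Vec d) 1

/-- The Laplace operator on polynomials in `d` variables. -/
def polyLaplacian (d : ℕ) : MvPolynomial (Fin d) ℝ →ₗ[ℝ] MvPolynomial (Fin d) ℝ :=
  ∑ i : Fin d, (MvPolynomial.pderiv i).toLinearMap ∘ₗ (MvPolynomial.pderiv i).toLinearMap

/-- Restriction of a polynomial to the unit sphere. -/
def restrictSphere (d : ℕ) : MvPolynomial (Fin d) ℝ →ₗ[ℝ] (UnitSphere d → ℝ) where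
  toFun p z := MvPolynomial.eval (fun i => (z : Vec d) i) p
  map_add' p q := by ext z; simp
  map_smul' c p := by ext z; simp

/-- Spherical harmonics of degree `l`: restrictions to the sphere of harmonic homogeneous
polynomials of degree `l`. -/
def sphericalHarmonics (d l : ℕ) : Submodule ℝ (UnitSphere d → ℝ) :=
  (MvPolynomial.homogeneousSubmodule (Fin d) ℝ l ⊓ LinearMap.ker (polyLaplacian d)).map
    (restrictSphere d)

/-- `N_{d,l}`, the dimension of the space of spherical harmonics of degree `l`. -/
def dimHarmonics (d l : ℕ) : ℕ := Module.finrank ℝ (sphericalHarmonics d l)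

/-- `κ_{d,l} = (2^l (d/2 - 1)_l / (d - 2)_l)^{1/2}`. For `d = 2` and `l ≥ 1` this reads `0 / 0` and
is understood by continuity in `d`, with value `(2^{l-1})^{1/2}`. (For `d = 1` and `l ≥ 2` the
denominator vanishes as well; there `N_{d,l} = 0` and the value of `κ_{d,l}` plays no role.) -/
def kappa (d l : ℕ) : ℝ :=
  if d = 2 then √(2 ^ (l - 1))
  else √(2 ^ l * rising ((d : ℝ) / 2 - 1) l / rising ((d : ℝ) - 2) l)

/-- The harmonic tensor `H_{d,l}(z)` of a point `z` of the sphere. -/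
def harmonicTensor (d l : ℕ) (z : UnitSphere d) : Tensor d l :=
  (kappa d l * √(dimHarmonics d l : ℝ)) • tfProj (vecPow (z : Vec d) l)

/-! ### Hermite tensors -/

/-- The standard Gaussian density on `ℝ^d`. -/
def gaussDensity (d : ℕ) (x : Vec d) : ℝ :=
  (2 * Real.pi) ^ (-((d : ℝ) / 2)) * Real.exp (-(‖x‖ ^ 2 / 2))

/-- The normalized Hermite tensor `(-1)^k / √k! * (∇^k γ_d)(x) / γ_d(x)`; the entry with index `i`
of `∇^k γ_d` is the partial derivative in the coordinate directions `i 0, …, i (k - 1)`. -/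
def hermiteTensor (d k : ℕ) (x : Vec d) : Tensor d k :=
  WithLp.toLp 2 fun i =>
    (-1) ^ k / √(k ! : ℝ) *
      (iteratedFDeriv ℝ k (gaussDensity d) x (fun a => EuclideanSpace.single (i a) (1 : ℝ)) /
        gaussDensity d x)

/-! ### The coefficients -/

/-- `f_{l,j} = l! / (2^{2j} j! (l - 2j)! (d/2 + l - 2j)_j)`, for `2 j ≤ l`. -/
def fischerCoeff (d l j : ℕ) : ℝ :=
  (l ! : ℝ) / (2 ^ (2 * j) * (j ! : ℝ) * ((l - 2 * j)! : ℝ) *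
    rising ((d : ℝ) / 2 + (l : ℝ) - 2 * (j : ℝ)) j)

/-- The coefficient `β_{k,k-2j}(r)` in dimension `d`, for `2 j ≤ k`. -/
def hermiteBeta (d k j : ℕ) (r : ℝ) : ℝ :=
  √(k ! : ℝ) / (kappa d (k - 2 * j) * √(dimHarmonics d (k - 2 * j) : ℝ)) *
    ∑ i ∈ Finset.range (j + 1),
      (-1) ^ i * r ^ (k - 2 * i) / (2 ^ i * (i ! : ℝ) * ((k - 2 * i)! : ℝ)) *
        fischerCoeff d (k - 2 * i) (j - i)

/-- The generalized Laguerre polynomial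
`L_n^{(α)}(x) = ∑_t (-1)^t binom(n + α, n - t) x^t / t!`, where
`binom(n + α, n - t) = (α + t + 1)_{n-t} / (n - t)!`. -/
def laguerre (n : ℕ) (α x : ℝ) : ℝ :=
  ∑ t ∈ Finset.range (n + 1),
    (-1) ^ t * (rising (α + (t : ℝ) + 1) (n - t) / ((n - t)! : ℝ)) * (x ^ t / (t ! : ℝ))

/-- The chi distribution with `d ≥ 1` degrees of freedom, i.e. the law of the Euclidean norm of a
standard Gaussian vector in `ℝ^d`, given by its density
`2^{1 - d/2} Γ(d/2)⁻¹ r^{d-1} e^{-r²/2}` on `(0, ∞)`. -/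
def chi (d : ℕ) : MeasureTheory.Measure ℝ :=
  (MeasureTheory.volume.restrict (Set.Ioi (0 : ℝ))).withDensity fun r =>
    ENNReal.ofReal (2 ^ (1 - (d : ℝ) / 2) / Real.Gamma ((d : ℝ) / 2) * r ^ (d - 1) *
      Real.exp (-(r ^ 2 / 2)))

/-- The mean of `β_{l+2j,l}(r)` for `r` chi-distributed with `d` degrees of freedom. -/
def betaMean (d l j : ℕ) : ℝ := ∫ r, hermiteBeta d (l + 2 * j) j r ∂(chi d)

/-- The second moment of `β_{l+2j,l}(r)` for `r` chi-distributed with `d` degrees of freedom. -/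
def betaSecondMoment (d l j : ℕ) : ℝ := ∫ r, hermiteBeta d (l + 2 * j) j r ^ 2 ∂(chi d)

end HermiteHarmonic

end

/-! A symmetric tensor `A` of order k is determined by the polynomial y ↦ ⟨A, y^{⊗k}⟩
(`symTensors_ext`). In this dictionary symmetrization is invisible, the tensor product becomes the
product, I becomes |y|², and the partial trace becomes the Laplacian up to a constant. The
decomposition is therefore a polynomial identity in y. Differentiating the Gaussian k times along y
gives a Hermite polynomial in ⟨x, y⟩, homogenized by |y|² (`iteratedFDeriv_gaussDensity_diag`), so
`He_k(x)` corresponds to a combination of the |y|^{2i} ⟨x, y⟩^{k-2i}. Each power of ⟨x, y⟩ is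
expanded by its Fischer decomposition (`linearPoly_pow_eq`), and collecting the total power of |y|²
produces β. Where κ√N vanishes, so does the traceless projection
(`tfProj_eq_zero_of_kappa_mul_eq_zero`), so dividing by zero does no harm.

Reversing the sum in β gives the Laguerre form. Chi moments are Gamma quotients, and Chu-Vandermonde
turns the chi-integral of r^n L_j^{(α)}(r²/2) into a moment times (α + 1 - (d+n)/2)_j / j!
(`integral_pow_mul_laguerre`). With α = d/2 + l - 1, the exponent n = l gives (l/2)_j, which is zero
when l = 0 < j; the exponents n = 2l + 2m give (-m)_j, which is zero for m < j. The last fact is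
Laguerre orthogonality and leaves one term in the second moment.

Both moments are then explicit products. Ratios of consecutive ones are rational in d, l, j. The
orders in d follow by multiplying those of the factors: κ² is bounded above and below, N lies
between binom(d, l) and d^l, the rising factorials (d/2 + c)_n have order d^n, and the squared l-th
chi moment has order d^l. -/

namespace HermiteHarmonic

/-! ### Symmetric tensors as homogeneous polynomials -/

section

open MvPolynomial

variable {d : ℕ}

/-- The polynomial `y ↦ ⟨A, y^{⊗ k}⟩` attached to a tensor `A` of order `k`. -/
noncomputable def tensorPoly (d k : ℕ) : Tensor d k →ₗ[ℝ] MvPolynomial (Fin d) ℝ where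
  toFun A := ∑ i : Fin k → Fin d, C (A i) * ∏ a, X (i a)
  map_add' A B := by simp [add_mul, Finset.sum_add_distrib]
  map_smul' c A := by simp [Finset.mul_sum, MvPolynomial.smul_eq_C_mul, mul_assoc]

/-- The tensor obtained by fixing the first index. -/
noncomputable def slice {k : ℕ} (s : Fin d) (A : Tensor d (k + 1)) : Tensor d k :=
  WithLp.toLp 2 fun i => A (Fin.cons s i)

/-- The squared Euclidean norm as a polynomial. -/
noncomputable def normSqPoly (d : ℕ) : MvPolynomial (Fin d) ℝ := ∑ i, X i ^ 2

/-- The linear form `y ↦ ⟨x, y⟩` as a polynomial. -/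
noncomputable def linearPoly (x : Vec d) : MvPolynomial (Fin d) ℝ := ∑ i, C (x i) * X i

/-- The tensor product of the identity matrix, in the first two indices, with a tensor. -/
noncomputable def idMul {k : ℕ} (G : Tensor d k) : Tensor d (k + 2) :=
  WithLp.toLp 2 fun i => (if i 0 = i 1 then 1 else 0) * G (Fin.tail (Fin.tail i))

theorem tensorPoly_apply {k : ℕ} (A : Tensor d k) :
    tensorPoly d k A = ∑ i : Fin k → Fin d, C (A i) * ∏ a, X (i a) := rfl

theorem sum_fin_succ_fun {M : Type*} [AddCommMonoid M] {k : ℕ} (f : (Fin (k + 1) → Fin d) → M) :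
    ∑ i, f i = ∑ s, ∑ i, f (Fin.cons s i) := by
  rw [← (Fin.consEquiv (fun _ => Fin d)).sum_comp, Fintype.sum_prod_type]
  rfl

theorem tensorPoly_zero_order (A : Tensor d 0) (i : Fin 0 → Fin d) :
    tensorPoly d 0 A = C (A i) := by
  rw [tensorPoly_apply, Fintype.sum_unique, Subsingleton.elim i default]
  simp

theorem tensorPoly_succ {k : ℕ} (A : Tensor d (k + 1)) :
    tensorPoly d (k + 1) A = ∑ s, X s * tensorPoly d k (slice s A) := by
  rw [tensorPoly_apply, sum_fin_succ_fun]
  refine Finset.sum_congr rfl fun s _ => ?_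
  rw [tensorPoly_apply, Finset.mul_sum]
  refine Finset.sum_congr rfl fun i _ => ?_
  rw [Fin.prod_univ_succ]
  simp only [Fin.cons_zero, Fin.cons_succ, slice]
  ring

theorem slice_mem_symTensors {k : ℕ} {A : Tensor d (k + 1)} (hA : A ∈ symTensors d (k + 1))
    (s : Fin d) : slice s A ∈ symTensors d k := by
  intro σ i
  -- The permutation that fixes 0 and acts as `σ` on the remaining indices.
  have h := hA (Equiv.Perm.decomposeFin.symm (0, σ)) (Fin.cons s i)
  change A _ = A _
  rw [← h]
  refine congrArg A.ofLp (funext fun a => ?_)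
  refine Fin.cases ?_ (fun a => ?_) a
  · simp
  · simp [Equiv.Perm.decomposeFin_symm_apply_succ]

theorem slice_comm {k : ℕ} {A : Tensor d (k + 2)} (hA : A ∈ symTensors d (k + 2))
    (s t : Fin d) : slice s (slice t A) = slice t (slice s A) := by
  ext i
  have h := hA (Equiv.swap 0 1) (Fin.cons t (Fin.cons s i))
  change A _ = A _
  rw [← h]
  refine congrArg A.ofLp (funext fun a => ?_)
  refine Fin.cases ?_ (fun a => ?_) a
  · rw [Equiv.swap_apply_left]; rfl
  · refine Fin.cases ?_ (fun a => ?_) a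
    · exact (congrArg _ (Equiv.swap_apply_right (0 : Fin (k + 2)) 1)).trans rfl
    · rw [Equiv.swap_apply_of_ne_of_ne (Fin.succ_ne_zero _)
        (by rw [← Fin.succ_zero_eq_one]; exact fun h => Fin.succ_ne_zero _ (Fin.succ_injective _ h))]
      rfl

/-- Split off the first index and apply the product rule: one term is the polynomial of the slice
itself, and the others, by induction and the commutation of slices, reassemble into multiples of the
same polynomial. -/
theorem pderiv_tensorPoly {k : ℕ} {A : Tensor d (k + 1)} (hA : A ∈ symTensors d (k + 1))
    (s : Fin d) :
    pderiv s (tensorPoly d (k + 1) A) = ((k : ℝ) + 1) • tensorPoly d k (slice s A) := by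
  induction k with
  | zero =>
    rw [tensorPoly_succ]
    simp only [tensorPoly_zero_order _ Fin.elim0, map_sum, Derivation.leibniz, pderiv_C, pderiv_X,
      Pi.single_apply]
    simp
  | succ k ih =>
    rw [tensorPoly_succ, map_sum]
    simp only [Derivation.leibniz, ih (slice_mem_symTensors hA _), pderiv_X, Pi.single_apply]
    rw [Finset.sum_add_distrib]
    simp only [smul_eq_mul, mul_smul_comm, ← Finset.smul_sum, slice_comm hA s, ← tensorPoly_succ]
    simp [add_smul]

/-- The partial derivatives of the polynomial recover the slices, so induction on the order recovers
all entries. -/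
theorem symTensors_ext {k : ℕ} {A B : Tensor d k} (hA : A ∈ symTensors d k)
    (hB : B ∈ symTensors d k) (h : tensorPoly d k A = tensorPoly d k B) : A = B := by
  induction k with
  | zero =>
    ext i
    rw [tensorPoly_zero_order _ i, tensorPoly_zero_order _ i] at h
    exact C_injective _ _ h
  | succ k ih =>
    ext i
    have h1 : slice (i 0) A = slice (i 0) B := by
      refine ih (slice_mem_symTensors hA _) (slice_mem_symTensors hB _) ?_
      have h2 := congrArg (pderiv (i 0)) h
      rw [pderiv_tensorPoly hA, pderiv_tensorPoly hB] at h2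
      exact smul_right_injective _ (by positivity : (k : ℝ) + 1 ≠ 0) h2
    have h3 := congrArg (fun T : Tensor d k => T (Fin.tail i)) h1
    simpa [slice, Fin.cons_self_tail] using h3

theorem partialTrace_eq_sum_slice {k : ℕ} (A : Tensor d (k + 2)) :
    partialTrace d k A = ∑ s, slice s (slice s A) := by
  ext i
  simp [partialTrace, slice]

theorem partialTrace_mem_symTensors {k : ℕ} {A : Tensor d (k + 2)}
    (hA : A ∈ symTensors d (k + 2)) : partialTrace d k A ∈ symTensors d k := by
  rw [partialTrace_eq_sum_slice]
  exact Submodule.sum_mem _ fun s _ => slice_mem_symTensors (slice_mem_symTensors hA s) s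

theorem polyLaplacian_apply (p : MvPolynomial (Fin d) ℝ) :
    polyLaplacian d p = ∑ i, pderiv i (pderiv i p) := by
  simp [polyLaplacian]

theorem polyLaplacian_tensorPoly {k : ℕ} {A : Tensor d (k + 2)} (hA : A ∈ symTensors d (k + 2)) :
    polyLaplacian d (tensorPoly d (k + 2) A) =
      (((k : ℝ) + 2) * ((k : ℝ) + 1)) • tensorPoly d k (partialTrace d k A) := by
  rw [polyLaplacian_apply, partialTrace_eq_sum_slice, map_sum, Finset.smul_sum]
  refine Finset.sum_congr rfl fun s _ => ?_
  rw [pderiv_tensorPoly hA, Derivation.map_smul, pderiv_tensorPoly (slice_mem_symTensors hA s),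
    smul_smul]
  congr 1
  push_cast
  ring

theorem tensorPoly_isHomogeneous {k : ℕ} (A : Tensor d k) :
    (tensorPoly d k A).IsHomogeneous k := by
  refine IsHomogeneous.sum _ _ _ fun i _ => ?_
  have h := (isHomogeneous_C (Fin d) (A i)).mul
    (IsHomogeneous.prod Finset.univ (fun a => X (R := ℝ) (i a)) (fun _ => 1)
      fun a _ => isHomogeneous_X _ _)
  simpa using h

/-- By Euler's identity (k+1) p = ∑ X_s ∂_s p, tensors for the partial derivatives can serve as
slices of a tensor for p. The result need not be symmetric; it is symmetrized where that matters. -/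
theorem exists_tensorPoly_eq {k : ℕ} {p : MvPolynomial (Fin d) ℝ} (hp : p.IsHomogeneous k) :
    ∃ A : Tensor d k, tensorPoly d k A = p := by
  induction k generalizing p with
  | zero =>
    refine ⟨WithLp.toLp 2 fun _ => coeff 0 p, ?_⟩
    rw [tensorPoly_zero_order _ Fin.elim0]
    exact (totalDegree_eq_zero_iff_eq_C.1 (Nat.le_zero.1 hp.totalDegree_le)).symm
  | succ k ih =>
    choose B hB using fun s => ih (hp.pderiv (i := s))
    refine ⟨WithLp.toLp 2 fun i => ((k : ℝ) + 1)⁻¹ * B (i 0) (Fin.tail i), ?_⟩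
    have h : ∀ s, slice s (WithLp.toLp 2 fun i => ((k : ℝ) + 1)⁻¹ * B (i 0) (Fin.tail i) :
        Tensor d (k + 1)) = ((k : ℝ) + 1)⁻¹ • B s := by
      intro s
      ext i
      simp [slice]
    rw [tensorPoly_succ]
    simp only [h, map_smul, hB, mul_smul_comm, ← Finset.smul_sum]
    rw [hp.sum_X_mul_pderiv, ← Nat.cast_smul_eq_nsmul ℝ, smul_smul]
    rw [inv_mul_eq_div]
    push_cast
    rw [div_self (by positivity), one_smul]

theorem slice_slice_idMul {k : ℕ} (G : Tensor d k) (s t : Fin d) :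
    slice s (slice t (idMul G)) = if t = s then G else 0 := by
  ext i
  have : (idMul G) (Fin.cons t (Fin.cons s i)) = (if t = s then 1 else 0) * G i := rfl
  change (idMul G) (Fin.cons t (Fin.cons s i)) = _
  rw [this]
  split_ifs <;> simp

theorem tensorPoly_idMul {k : ℕ} (G : Tensor d k) :
    tensorPoly d (k + 2) (idMul G) = normSqPoly d * tensorPoly d k G := by
  rw [tensorPoly_succ, normSqPoly, Finset.sum_mul]
  refine Finset.sum_congr rfl fun s _ => ?_
  rw [tensorPoly_succ]
  simp only [slice_slice_idMul]
  rw [Finset.sum_eq_single s]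
  · rw [if_pos rfl]; ring
  · intro b _ hb; rw [if_neg (Ne.symm hb)]; simp
  · simp

theorem inner_eq_sum {k : ℕ} (A B : Tensor d k) : inner ℝ A B = ∑ i, A i * B i := by
  simp [PiLp.inner_apply, mul_comm]

/-- Multiplication by I is adjoint to the partial trace; this is what makes symmetrized multiples of
I orthogonal to traceless symmetric tensors. -/
theorem inner_idMul {k : ℕ} (G : Tensor d k) (B : Tensor d (k + 2)) :
    inner ℝ (idMul G) B = inner ℝ G (partialTrace d k B) := by
  rw [inner_eq_sum, inner_eq_sum, sum_fin_succ_fun]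
  simp only [sum_fin_succ_fun (k := k)]
  have h : ∀ s t i, (idMul G) (Fin.cons s (Fin.cons t i)) = (if s = t then 1 else 0) * G i :=
    fun _ _ _ => rfl
  have h' : ∀ i, (partialTrace d k B) i = ∑ s : Fin d, B (Fin.cons s (Fin.cons s i)) :=
    fun _ => rfl
  simp only [h, h', Finset.mul_sum]
  rw [Finset.sum_comm (s := (Finset.univ : Finset (Fin k → Fin d)))]
  refine Finset.sum_congr rfl fun s _ => ?_
  rw [Finset.sum_eq_single s]
  · simp
  · intro b _ hb; simp [Ne.symm hb]
  · simp

theorem symProj_apply {k : ℕ} (A : Tensor d k) (i : Fin k → Fin d) :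
    symProj A i = (1 / (k ! : ℝ)) * ∑ σ : Equiv.Perm (Fin k), A (fun a => i (σ a)) := rfl

theorem symProj_mem_symTensors {k : ℕ} (A : Tensor d k) : symProj A ∈ symTensors d k := by
  intro τ i
  rw [symProj_apply, symProj_apply]
  congr 1
  exact Fintype.sum_equiv (Equiv.mulLeft τ) _ _ fun σ => rfl

theorem sum_perm_comp {M : Type*} [AddCommMonoid M] {k : ℕ} (σ : Equiv.Perm (Fin k))
    (f : (Fin k → Fin d) → M) : ∑ i : Fin k → Fin d, f (fun a => i (σ a)) = ∑ i, f i :=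
  (Equiv.arrowCongr σ.symm (Equiv.refl (Fin d))).sum_comp f

/-- Permuting indices does not change the commutative monomial, so every term of the average
contributes the same polynomial. -/
theorem tensorPoly_symProj {k : ℕ} (A : Tensor d k) :
    tensorPoly d k (symProj A) = tensorPoly d k A := by
  have h : ∀ σ : Equiv.Perm (Fin k),
      ∑ i : Fin k → Fin d, C (A fun a => i (σ a)) * ∏ a, X (i a) = tensorPoly d k A := by
    intro σ
    rw [tensorPoly_apply, ← sum_perm_comp σ fun i => C (A i) * ∏ a, X (i a)]
    refine Finset.sum_congr rfl fun i _ => ?_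
    rw [Equiv.prod_comp σ (fun a => X (R := ℝ) (i a))]
  rw [tensorPoly_apply]
  simp only [symProj_apply, C_mul, map_sum, Finset.sum_mul, mul_assoc]
  rw [← Finset.mul_sum, Finset.sum_comm]
  simp only [h, Finset.sum_const, Finset.card_univ, Fintype.card_perm, Fintype.card_fin]
  rw [← Nat.cast_smul_eq_nsmul ℝ, ← smul_eq_C_mul, smul_smul, one_div, inv_mul_cancel₀, one_smul]
  positivity

theorem inner_symProj {k : ℕ} (A : Tensor d k) {B : Tensor d k} (hB : B ∈ symTensors d k) :
    inner ℝ (symProj A) B = inner ℝ A B := by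
  have h : ∀ σ : Equiv.Perm (Fin k),
      ∑ i : Fin k → Fin d, (A fun a => i (σ a)) * B i = inner ℝ A B := by
    intro σ
    rw [inner_eq_sum, ← sum_perm_comp σ fun i => A i * B i]
    refine Finset.sum_congr rfl fun i _ => ?_
    rw [hB σ i]
  rw [inner_eq_sum]
  simp only [symProj_apply, Finset.sum_mul, mul_assoc]
  rw [← Finset.mul_sum, Finset.sum_comm]
  simp only [h, Finset.sum_const, Finset.card_univ, Fintype.card_perm, Fintype.card_fin]
  rw [nsmul_eq_mul, ← mul_assoc, one_div, inv_mul_cancel₀, one_mul]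
  positivity

theorem tensorPoly_castOrder {m n : ℕ} (h : m = n) (A : Tensor d m) :
    tensorPoly d n (castOrder h A) = tensorPoly d m A := by
  subst h
  rfl

theorem tensorPoly_tmul {p q : ℕ} (A : Tensor d p) (B : Tensor d q) :
    tensorPoly d (p + q) (tmul A B) = tensorPoly d p A * tensorPoly d q B := by
  rw [tensorPoly_apply, ← (Fin.appendEquiv p q).sum_comp, Fintype.sum_prod_type,
    tensorPoly_apply, tensorPoly_apply, Finset.sum_mul_sum]
  refine Finset.sum_congr rfl fun i _ => Finset.sum_congr rfl fun j _ => ?_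
  simp only [Fin.appendEquiv, Equiv.coe_fn_mk, tmul, Fin.append_left, Fin.append_right,
    Fin.prod_univ_add, C_mul]
  ring

theorem tensorPoly_idPow (j : ℕ) : tensorPoly d (2 * j) (idPow d j) = normSqPoly d ^ j := by
  induction j with
  | zero =>
    rw [pow_zero, ← C_1]
    refine (tensorPoly_zero_order _ Fin.elim0).trans ?_
    simp [idPow]
  | succ j ih =>
    have h : idPow d (j + 1) = (idMul (idPow d j) : Tensor d (2 * j + 2)) := by
      ext i
      change ∏ m : Fin (j + 1), _ = _ * ∏ m : Fin j, _
      rw [Fin.prod_univ_succ]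
      rfl
    rw [h]
    refine (tensorPoly_idMul _).trans ?_
    rw [pow_succ', ← ih]
    rfl

theorem vecPow_mem_symTensors (x : Vec d) (k : ℕ) : vecPow x k ∈ symTensors d k := by
  intro σ i
  exact Equiv.prod_comp σ (fun a => x (i a))

theorem slice_vecPow (x : Vec d) (k : ℕ) (s : Fin d) :
    slice s (vecPow x (k + 1)) = x s • vecPow x k := by
  ext i
  simp [slice, vecPow, Fin.prod_univ_succ]

theorem tensorPoly_vecPow (x : Vec d) (k : ℕ) :
    tensorPoly d k (vecPow x k) = linearPoly x ^ k := by
  induction k with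
  | zero =>
    rw [tensorPoly_zero_order _ Fin.elim0]
    simp [vecPow]
  | succ k ih =>
    rw [tensorPoly_succ, pow_succ', linearPoly, Finset.sum_mul]
    refine Finset.sum_congr rfl fun s _ => ?_
    rw [slice_vecPow, map_smul, ih, smul_eq_C_mul, linearPoly]
    ring

theorem partialTrace_vecPow (x : Vec d) (k : ℕ) :
    partialTrace d k (vecPow x (k + 2)) = ‖x‖ ^ 2 • vecPow x k := by
  rw [partialTrace_eq_sum_slice, EuclideanSpace.real_norm_sq_eq, Finset.sum_smul]
  refine Finset.sum_congr rfl fun s _ => ?_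
  have : ∀ c : ℝ, slice s (c • vecPow x (k + 1)) = c • slice s (vecPow x (k + 1)) := fun c => rfl
  rw [slice_vecPow, this, slice_vecPow, smul_smul, sq]

end

/-! ### Fischer decomposition of powers of a linear form -/

section

open MvPolynomial

variable {d : ℕ}

theorem tracelessSym_le_symTensors (d k : ℕ) : tracelessSym d k ≤ symTensors d k := by
  rcases k with _ | _ | k
  · exact le_rfl
  · exact le_rfl
  · exact inf_le_left

theorem polyLaplacian_tensorPoly_of_mem_tracelessSym {k : ℕ} {A : Tensor d k}
    (hA : A ∈ tracelessSym d k) : polyLaplacian d (tensorPoly d k A) = 0 := by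
  rcases k with _ | _ | k
  · rw [tensorPoly_zero_order _ Fin.elim0, polyLaplacian_apply]
    simp
  · rw [tensorPoly_succ, polyLaplacian_apply]
    simp only [tensorPoly_zero_order _ Fin.elim0]
    refine Finset.sum_eq_zero fun i _ => ?_
    simp [Pi.single_apply]
  · rw [polyLaplacian_tensorPoly hA.1, LinearMap.mem_ker.1 hA.2, map_zero, smul_zero]

theorem pderiv_normSqPoly (i : Fin d) : pderiv i (normSqPoly d) = 2 * X i := by
  simp only [normSqPoly, map_sum, sq, Derivation.leibniz, pderiv_X, Pi.single_apply, smul_eq_mul]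
  simp [Finset.sum_add_distrib, two_mul]

/-- Here Δ|y|² = 2d, and the cross term 2 ∇|y|² · ∇p = 4 y · ∇p is 4n p by Euler's identity. -/
theorem polyLaplacian_normSqPoly_mul {n : ℕ} {p : MvPolynomial (Fin d) ℝ}
    (hp : p.IsHomogeneous n) :
    polyLaplacian d (normSqPoly d * p) =
      (2 * (d : ℝ) + 4 * n) • p + normSqPoly d * polyLaplacian d p := by
  rw [polyLaplacian_apply, polyLaplacian_apply, Finset.mul_sum]
  have h : ∀ i, pderiv i (pderiv i (normSqPoly d * p)) =
      2 * p + (4 : ℝ) • (X i * pderiv i p) + normSqPoly d * pderiv i (pderiv i p) := by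
    intro i
    have h2 : pderiv i (2 : MvPolynomial (Fin d) ℝ) = 0 := by
      simpa using (pderiv i).map_natCast 2
    simp only [Derivation.leibniz, pderiv_normSqPoly, map_add, smul_eq_mul, pderiv_X_self, h2]
    rw [smul_eq_C_mul, show (C (4 : ℝ) : MvPolynomial (Fin d) ℝ) = 4 from map_ofNat C 4]
    ring
  simp only [h, Finset.sum_add_distrib, ← Finset.smul_sum, hp.sum_X_mul_pderiv]
  congr 1
  rw [Finset.sum_const, Finset.card_univ, Fintype.card_fin, ← Nat.cast_smul_eq_nsmul ℝ,
    ← Nat.cast_smul_eq_nsmul ℝ, show (2 : MvPolynomial (Fin d) ℝ) = C 2 from (map_ofNat C 2).symm,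
    ← smul_eq_C_mul, smul_smul, smul_smul, ← add_smul, mul_comm (d : ℝ)]

theorem normSqPoly_isHomogeneous : (normSqPoly d).IsHomogeneous 2 :=
  IsHomogeneous.sum _ _ _ fun i _ => by simpa using (isHomogeneous_X ℝ i).pow 2

theorem polyLaplacian_normSqPoly_pow_mul {n : ℕ} {p : MvPolynomial (Fin d) ℝ}
    (hp : p.IsHomogeneous n) (h0 : polyLaplacian d p = 0) (j : ℕ) :
    polyLaplacian d (normSqPoly d ^ (j + 1) * p) =
      (2 * ((j : ℝ) + 1) * (2 * j + 2 * n + d)) • (normSqPoly d ^ j * p) := by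
  induction j with
  | zero =>
    rw [pow_one, polyLaplacian_normSqPoly_mul hp, h0, pow_zero, mul_zero, add_zero, one_mul]
    congr 1
    push_cast
    ring
  | succ j ih =>
    have hq : (normSqPoly d ^ (j + 1) * p).IsHomogeneous (2 * (j + 1) + n) :=
      (normSqPoly_isHomogeneous.pow (j + 1)).mul hp
    rw [pow_succ', mul_assoc, polyLaplacian_normSqPoly_mul hq, ih, mul_smul_comm, ← mul_assoc,
      ← pow_succ', ← add_smul]
    congr 1
    push_cast
    ring

theorem rising_succ (a : ℝ) (n : ℕ) : rising a (n + 1) = rising a n * (a + n) := by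
  simp [rising, ascPochhammer_succ_eval]

@[simp] theorem rising_zero (a : ℝ) : rising a 0 = 1 := by simp [rising]

theorem rising_pos {a : ℝ} (ha : 0 < a) (n : ℕ) : 0 < rising a n := ascPochhammer_pos n a ha

theorem fischerCoeff_zero_right (d l : ℕ) : fischerCoeff d l 0 = 1 := by
  have : (l ! : ℝ) ≠ 0 := by positivity
  simp [fischerCoeff, this]

/-- The Fischer coefficients are compatible with the Laplacian. -/
theorem fischerCoeff_succ (hd : 1 ≤ d) {m j : ℕ} (hj : 2 * j ≤ m) :
    fischerCoeff d (m + 2) (j + 1) *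
        (2 * ((j : ℝ) + 1) * (2 * j + 2 * ((m - 2 * j : ℕ) : ℝ) + d)) =
      ((m : ℝ) + 2) * (m + 1) * fischerCoeff d m j := by
  obtain ⟨n, rfl⟩ := Nat.exists_eq_add_of_le' hj
  have e1 : n + 2 * j + 2 - 2 * (j + 1) = n := by omega
  have e2 : n + 2 * j - 2 * j = n := by omega
  have hd' : (1 : ℝ) ≤ d := by exact_mod_cast hd
  have e3 : (d : ℝ) / 2 + ((n + 2 * j + 2 : ℕ) : ℝ) - 2 * ((j + 1 : ℕ) : ℝ) = d / 2 + n := by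
    push_cast; ring
  have e4 : (d : ℝ) / 2 + ((n + 2 * j : ℕ) : ℝ) - 2 * (j : ℝ) = d / 2 + n := by
    push_cast; ring
  have hr := rising_pos (show (0 : ℝ) < d / 2 + n by positivity) j
  have hr2 : (0 : ℝ) < d / 2 + n + j := by positivity
  simp only [fischerCoeff, e1, e2, e3, e4, rising_succ]
  rw [Nat.factorial_succ (n + 2 * j + 1), Nat.factorial_succ (n + 2 * j), Nat.factorial_succ j]
  push_cast
  have hj1 : (0 : ℝ) < (j : ℝ) + 1 := by positivity
  have hjf : (0 : ℝ) < (j ! : ℝ) := by positivity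
  have hnf : (0 : ℝ) < (n ! : ℝ) := by positivity
  generalize rising (d / 2 + n) j = R at *
  rw [show 2 * (j + 1) = 2 * j + 2 by ring, pow_add]
  have h2 : (d : ℝ) + 2 * n + 2 * j ≠ 0 := by positivity
  field_simp
  ring

theorem tfProj_mem {k : ℕ} (A : Tensor d k) : tfProj A ∈ tracelessSym d k :=
  Submodule.coe_mem _

theorem tfProj_eq_self {k : ℕ} {A : Tensor d k} (hA : A ∈ tracelessSym d k) : tfProj A = A :=
  Submodule.starProjection_eq_self_iff.2 hA

/-- The Fischer decomposition of a power of a linear form. -/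
theorem linearPoly_pow_eq (hd : 1 ≤ d) {z : Vec d} (hz : ‖z‖ = 1) (l : ℕ) :
    linearPoly z ^ l = ∑ j ∈ Finset.range (l / 2 + 1),
      fischerCoeff d l j • (normSqPoly d ^ j *
        tensorPoly d (l - 2 * j) (tfProj (vecPow z (l - 2 * j)))) := by
  induction l using Nat.strong_induction_on with
  | _ l ih =>
  rcases l with _ | _ | m
  · have h : tfProj (vecPow z 0) = vecPow z 0 := tfProj_eq_self (vecPow_mem_symTensors z 0)
    simp [fischerCoeff_zero_right, h, tensorPoly_vecPow]
  · have h : tfProj (vecPow z 1) = vecPow z 1 := tfProj_eq_self (vecPow_mem_symTensors z 1)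
    simp [fischerCoeff_zero_right, h, tensorPoly_vecPow]
  · have ihm := ih m (by omega)
    set H : ℕ → MvPolynomial (Fin d) ℝ := fun n => tensorPoly d n (tfProj (vecPow z n)) with hH
    have hhom : (∑ j ∈ Finset.range (m / 2 + 1),
        fischerCoeff d (m + 2) (j + 1) • (normSqPoly d ^ j * H (m - 2 * j))).IsHomogeneous m := by
      refine IsHomogeneous.sum _ _ _ fun j hj => ?_
      have h := (normSqPoly_isHomogeneous (d := d).pow j).mul
        (tensorPoly_isHomogeneous (tfProj (vecPow z (m - 2 * j))))
      rw [show 2 * j + (m - 2 * j) = m by have := Finset.mem_range.1 hj; omega] at h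
      exact (homogeneousSubmodule (Fin d) ℝ m).smul_mem _ h
    obtain ⟨G, hG⟩ := exists_tensorPoly_eq hhom
    -- `G` encodes the predicted terms with j ≥ 1 after one factor |y|² is removed. Thus `D` is the
    -- candidate for the term j = 0, namely the traceless projection.
    set D : Tensor d (m + 2) := vecPow z (m + 2) - symProj (idMul G) with hDdef
    have hDsym : D ∈ symTensors d (m + 2) :=
      Submodule.sub_mem _ (vecPow_mem_symTensors _ _) (symProj_mem_symTensors _)
    have hDpoly : tensorPoly d (m + 2) D = linearPoly z ^ (m + 2) -
        ∑ j ∈ Finset.range (m / 2 + 1),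
          fischerCoeff d (m + 2) (j + 1) • (normSqPoly d ^ (j + 1) * H (m - 2 * j)) := by
      rw [map_sub, tensorPoly_vecPow, tensorPoly_symProj, tensorPoly_idMul, hG, Finset.mul_sum]
      congr 1
      refine Finset.sum_congr rfl fun j _ => ?_
      rw [mul_smul_comm, pow_succ', mul_assoc]
    -- As |z| = 1, the Laplacian lowers the power of ⟨z, y⟩ by two; the induction hypothesis at `m`
    -- and `fischerCoeff_succ` match it with the Laplacian of the subtracted terms.
    have hlap : polyLaplacian d (tensorPoly d (m + 2) D) = 0 := by
      rw [hDpoly, map_sub, map_sum, ← tensorPoly_vecPow,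
        polyLaplacian_tensorPoly (vecPow_mem_symTensors _ _), partialTrace_vecPow, hz, one_pow,
        one_smul, tensorPoly_vecPow, ihm, Finset.smul_sum, sub_eq_zero]
      refine Finset.sum_congr rfl fun j hj => ?_
      rw [map_smul, polyLaplacian_normSqPoly_pow_mul (tensorPoly_isHomogeneous _)
        (polyLaplacian_tensorPoly_of_mem_tracelessSym (tfProj_mem _)), smul_smul, smul_smul,
        fischerCoeff_succ hd (by have := Finset.mem_range.1 hj; omega)]
    have hDmem : D ∈ tracelessSym d (m + 2) := by
      refine ⟨hDsym, ?_⟩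
      rw [polyLaplacian_tensorPoly hDsym] at hlap
      have h0 := (smul_eq_zero.1 hlap).resolve_left (by positivity)
      refine symTensors_ext (partialTrace_mem_symTensors hDsym) (Submodule.zero_mem _) ?_
      rw [h0, map_zero]
    -- `D` is traceless and differs from the tensor power by a symmetrized multiple of I, which is
    -- orthogonal to the traceless tensors.
    have hproj : tfProj (vecPow z (m + 2)) = D := by
      refine Submodule.eq_starProjection_of_mem_of_inner_eq_zero hDmem fun B hB => ?_
      rw [hDdef, sub_sub_cancel, inner_symProj _ hB.1, inner_idMul, LinearMap.mem_ker.1 hB.2,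
        inner_zero_right]
    have hHD : H (m + 2) = tensorPoly d (m + 2) D := congrArg (tensorPoly d (m + 2)) hproj
    change linearPoly z ^ (m + 2) = ∑ j ∈ Finset.range ((m + 1 + 1) / 2 + 1),
      fischerCoeff d (m + 2) j • (normSqPoly d ^ j * H (m + 2 - 2 * j))
    have e : ∀ j, m + 2 - 2 * (j + 1) = m - 2 * j := fun j => by omega
    rw [show (m + 1 + 1) / 2 + 1 = m / 2 + 1 + 1 by omega, Finset.sum_range_succ']
    simp only [fischerCoeff_zero_right, one_smul, pow_zero, one_mul, mul_zero, Nat.sub_zero, e]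
    rw [hHD, hDpoly, add_sub_cancel]

end

/-! ### Gaussian derivatives and Hermite polynomials -/

section

variable {d : ℕ}

/-- The coefficient of `s^{k-2i} q^i` in `q^{k/2} Heₖ(s / q^{1/2})`. -/
noncomputable def hermiteCoeff (k i : ℕ) : ℝ :=
  if 2 * i ≤ k then (-1) ^ i * (k ! : ℝ) / (2 ^ i * (i ! : ℝ) * ((k - 2 * i)! : ℝ)) else 0

/-- The homogenized Hermite polynomial of degree `k`. -/
noncomputable def hermiteHom (q : ℝ) (k : ℕ) (s : ℝ) : ℝ :=
  ∑ i ∈ Finset.range (k / 2 + 1), hermiteCoeff k i * s ^ (k - 2 * i) * q ^ i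

theorem hermiteCoeff_eq_zero {k i : ℕ} (h : k < 2 * i) : hermiteCoeff k i = 0 :=
  if_neg (by omega)

theorem hermiteCoeff_zero_right (k : ℕ) : hermiteCoeff k 0 = 1 := by
  have : (k ! : ℝ) ≠ 0 := by positivity
  simp [hermiteCoeff, this]

/-- The recurrence of `hermiteHom_succ` read on coefficients. The cases k ≤ 2i and k = 2i + 1 are
separate because some coefficients are zero there by convention. -/
theorem hermiteCoeff_succ_succ (k i : ℕ) :
    hermiteCoeff (k + 1) (i + 1) =
      hermiteCoeff k (i + 1) - ((k - 2 * i : ℕ) : ℝ) * hermiteCoeff k i := by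
  rcases lt_trichotomy (k) (2 * i + 1) with h | h | h
  · rw [hermiteCoeff_eq_zero (by omega : k + 1 < 2 * (i + 1)),
      hermiteCoeff_eq_zero (by omega : k < 2 * (i + 1)), show k - 2 * i = 0 by omega]
    simp
  · subst h
    rw [hermiteCoeff_eq_zero (by omega : 2 * i + 1 < 2 * (i + 1)), hermiteCoeff, hermiteCoeff,
      if_pos (by omega), if_pos (by omega), show 2 * i + 1 + 1 - 2 * (i + 1) = 0 by omega,
      show 2 * i + 1 - 2 * i = 1 by omega, Nat.factorial_succ (2 * i + 1), Nat.factorial_succ i]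
    push_cast
    have h1 : (i ! : ℝ) ≠ 0 := by positivity
    have h2 : (i : ℝ) + 1 ≠ 0 := by positivity
    simp only [Nat.factorial_zero, Nat.factorial_one, Nat.cast_one, pow_succ]
    field_simp
    ring
  · obtain ⟨n, rfl⟩ := Nat.exists_eq_add_of_lt h
    rw [hermiteCoeff, hermiteCoeff, hermiteCoeff, if_pos (by omega), if_pos (by omega),
      if_pos (by omega), show 2 * i + 1 + n + 1 + 1 - 2 * (i + 1) = n + 1 by omega,
      show 2 * i + 1 + n + 1 - 2 * (i + 1) = n by omega,
      show 2 * i + 1 + n + 1 - 2 * i = n + 1 + 1 by omega,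
      Nat.factorial_succ (2 * i + 1 + n + 1), Nat.factorial_succ i, Nat.factorial_succ (n + 1),
      Nat.factorial_succ n]
    push_cast
    have h1 : (i ! : ℝ) ≠ 0 := by positivity
    have h2 : (i : ℝ) + 1 ≠ 0 := by positivity
    have h3 : (n ! : ℝ) ≠ 0 := by positivity
    have h4 : (n : ℝ) + 1 ≠ 0 := by positivity
    have h5 : (n : ℝ) + 1 + 1 ≠ 0 := by positivity
    simp only [pow_succ]
    field_simp
    ring

theorem hermiteHom_eq_sum_range (q : ℝ) {k n : ℕ} (hn : k / 2 + 1 ≤ n) (s : ℝ) :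
    hermiteHom q k s = ∑ i ∈ Finset.range n, hermiteCoeff k i * s ^ (k - 2 * i) * q ^ i := by
  refine Finset.sum_subset (Finset.range_subset_range.2 hn) fun i _ hi => ?_
  rw [hermiteCoeff_eq_zero (by rw [Finset.mem_range] at hi; omega)]
  ring

/-- The derivative of the homogenized Hermite polynomial. -/
noncomputable def hermiteHomDeriv (q : ℝ) (k : ℕ) (s : ℝ) : ℝ :=
  ∑ i ∈ Finset.range (k / 2 + 1),
    hermiteCoeff k i * (((k - 2 * i : ℕ) : ℝ) * s ^ (k - 2 * i - 1)) * q ^ i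

theorem hasDerivAt_hermiteHom (q : ℝ) (k : ℕ) (s : ℝ) :
    HasDerivAt (hermiteHom q k) (hermiteHomDeriv q k s) s := by
  unfold hermiteHom hermiteHomDeriv
  exact HasDerivAt.fun_sum fun i _ => ((hasDerivAt_pow _ s).const_mul _).mul_const _

theorem hermiteHom_succ (q : ℝ) (k : ℕ) (s : ℝ) :
    hermiteHom q (k + 1) s = s * hermiteHom q k s - q * hermiteHomDeriv q k s := by
  -- Both sums are padded with zero coefficients to a common length, so that splitting off i = 0
  -- aligns the shifted terms.
  rw [hermiteHom_eq_sum_range q (show (k + 1) / 2 + 1 ≤ k / 2 + 1 + 1 by omega),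
    hermiteHom_eq_sum_range q (show k / 2 + 1 ≤ k / 2 + 1 + 1 by omega),
    Finset.sum_range_succ' _ (k / 2 + 1), Finset.sum_range_succ' _ (k / 2 + 1), hermiteHomDeriv, mul_add, Finset.mul_sum,
    Finset.mul_sum, add_sub_right_comm, ← Finset.sum_sub_distrib]
  congr 1
  · refine Finset.sum_congr rfl fun i _ => ?_
    rw [hermiteCoeff_succ_succ, show k + 1 - 2 * (i + 1) = k - 2 * i - 1 by omega]
    by_cases h : 2 * (i + 1) ≤ k
    · rw [show k - 2 * i - 1 = k - 2 * (i + 1) + 1 by omega]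
      ring
    · rw [hermiteCoeff_eq_zero (by omega : k < 2 * (i + 1))]
      ring
  · rw [hermiteCoeff_zero_right, hermiteCoeff_zero_right]
    simp only [mul_zero, Nat.sub_zero, pow_zero]
    ring

theorem gaussDensity_contDiff (d : ℕ) : ContDiff ℝ ⊤ (gaussDensity d) := by
  unfold gaussDensity
  exact contDiff_const.mul (((contDiff_norm_sq ℝ).div_const 2).neg.exp)

theorem gaussDensity_pos (d : ℕ) (x : Vec d) : 0 < gaussDensity d x := by
  unfold gaussDensity
  positivity

theorem hasFDerivAt_gaussDensity (x : Vec d) :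
    HasFDerivAt (gaussDensity d) (-(gaussDensity d x) • innerSL ℝ x) x := by
  have h := ((((hasStrictFDerivAt_norm_sq x).hasFDerivAt.mul_const (2⁻¹ : ℝ)).neg).exp).const_mul
    ((2 * Real.pi) ^ (-((d : ℝ) / 2)))
  refine (h.congr_of_eventuallyEq ?_).congr_fderiv ?_
  · exact Filter.Eventually.of_forall fun y => by simp [gaussDensity, div_eq_mul_inv]
  · ext y
    simp [gaussDensity, div_eq_mul_inv]
    ring

/-- One more derivative along y multiplies the Gaussian by -⟨x, y⟩ and gives |y|² times the
derivative of the Hermite factor, which is minus the recurrence `hermiteHom_succ`. -/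
theorem iteratedFDeriv_gaussDensity_diag (y : Vec d) (k : ℕ) (x : Vec d) :
    iteratedFDeriv ℝ k (gaussDensity d) x (fun _ => y) =
      (-1) ^ k * hermiteHom (‖y‖ ^ 2) k (inner ℝ x y) * gaussDensity d x := by
  induction k generalizing x with
  | zero => simp [hermiteHom, hermiteCoeff_zero_right]
  | succ k ih =>
    have hdiff : DifferentiableAt ℝ (iteratedFDeriv ℝ k (gaussDensity d)) x :=
      (gaussDensity_contDiff d).differentiable_iteratedFDeriv
        (by exact_mod_cast WithTop.coe_lt_top _) x
    rw [iteratedFDeriv_succ_apply_left]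
    have h1 := (hdiff.hasFDerivAt.continuousMultilinear_apply_const (fun _ => y))
    have h2 : HasFDerivAt (fun x => (-1) ^ k * hermiteHom (‖y‖ ^ 2) k (inner ℝ x y)
        * gaussDensity d x) _ x :=
      (((hasDerivAt_hermiteHom (‖y‖ ^ 2) k (inner ℝ x y)).comp_hasFDerivAt x
        ((hasFDerivAt_id x).inner ℝ (hasFDerivAt_const y x))).const_mul ((-1) ^ k)).mul
        (hasFDerivAt_gaussDensity x)
    have h3 := h1.unique ((funext ih : (fun x => iteratedFDeriv ℝ k (gaussDensity d) x
      (fun _ => y)) = _) ▸ h2)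
    have h4 := congrArg (fun L : Vec d →L[ℝ] ℝ => L y) h3
    refine (Eq.trans ?_ h4).trans ?_
    · rfl
    · rw [hermiteHom_succ]
      simp
      ring

theorem hermiteTensor_mem_symTensors (k : ℕ) (x : Vec d) :
    hermiteTensor d k x ∈ symTensors d k := by
  intro σ i
  have h := (gaussDensity_contDiff d).contDiffAt (x := x) |>.iteratedFDeriv_comp_perm
    (fun a => EuclideanSpace.single (i a) (1 : ℝ)) σ
  change _ * (_ / _) = _ * (_ / _)
  rw [← h]
  rfl

theorem eval_tensorPoly {k : ℕ} (A : Tensor d k) (y : Vec d) :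
    MvPolynomial.eval (fun i => y i) (tensorPoly d k A) = ∑ i, A i * ∏ a, y (i a) := by
  simp [tensorPoly_apply, map_sum]

theorem eval_tensorPoly_hermiteTensor (k : ℕ) (x y : Vec d) :
    MvPolynomial.eval (fun i => y i) (tensorPoly d k (hermiteTensor d k x)) =
      (√(k ! : ℝ))⁻¹ * hermiteHom (‖y‖ ^ 2) k (inner ℝ x y) := by
  have hy : y = ∑ i, y i • EuclideanSpace.single i (1 : ℝ) := by
    ext j
    simp [Finset.sum_apply, Pi.single_apply]
  have h1 : iteratedFDeriv ℝ k (gaussDensity d) x (fun _ => y) =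
      ∑ i : Fin k → Fin d, (∏ a, y (i a)) *
        iteratedFDeriv ℝ k (gaussDensity d) x
          (fun a => EuclideanSpace.single (i a) (1 : ℝ)) := by
    -- Multilinear expansion in the standard basis turns the diagonal value along y into the sum
    -- over entries.
    conv_lhs => rw [hy]
    rw [ContinuousMultilinearMap.map_sum]
    refine Finset.sum_congr rfl fun i _ => ?_
    rw [ContinuousMultilinearMap.map_smul_univ, smul_eq_mul]
  rw [eval_tensorPoly]
  have hg := (gaussDensity_pos d x).ne'
  have h2 : ∀ i : Fin k → Fin d, hermiteTensor d k x i * ∏ a, y (i a) =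
      (-1) ^ k / √(k ! : ℝ) / gaussDensity d x * ((∏ a, y (i a)) *
        iteratedFDeriv ℝ k (gaussDensity d) x
          (fun a => EuclideanSpace.single (i a) (1 : ℝ))) := by
    intro i
    change (_ * (_ / _)) * _ = _
    ring
  simp only [h2]
  rw [← Finset.mul_sum, ← h1, iteratedFDeriv_gaussDensity_diag]
  have h3 : ((-1 : ℝ) ^ k) * (-1) ^ k = 1 := by rw [← mul_pow]; simp
  field_simp
  linear_combination (hermiteHom (‖y‖ ^ 2) k (inner ℝ x y)) * h3

theorem eval_linearPoly (x y : Vec d) :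
    MvPolynomial.eval (fun i => y i) (linearPoly x) = inner ℝ x y := by
  simp [linearPoly, PiLp.inner_apply, mul_comm]

theorem eval_normSqPoly (y : Vec d) :
    MvPolynomial.eval (fun i => y i) (normSqPoly d) = ‖y‖ ^ 2 := by
  simp [normSqPoly, EuclideanSpace.real_norm_sq_eq]

theorem poly_ext {p q : MvPolynomial (Fin d) ℝ}
    (h : ∀ y : Vec d, MvPolynomial.eval (fun i => y i) p = MvPolynomial.eval (fun i => y i) q) :
    p = q :=
  MvPolynomial.funext fun y => h (WithLp.toLp 2 y)

theorem tensorPoly_hermiteTensor (k : ℕ) (x : Vec d) :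
    tensorPoly d k (hermiteTensor d k x) = ∑ i ∈ Finset.range (k / 2 + 1),
      ((√(k ! : ℝ))⁻¹ * hermiteCoeff k i) • (normSqPoly d ^ i * linearPoly x ^ (k - 2 * i)) := by
  refine poly_ext fun y => ?_
  rw [eval_tensorPoly_hermiteTensor, hermiteHom, map_sum, Finset.mul_sum]
  refine Finset.sum_congr rfl fun i _ => ?_
  rw [MvPolynomial.smul_eval, map_mul, map_pow, map_pow, eval_linearPoly, eval_normSqPoly]
  ring

end

/-! ### Dimension of spherical harmonics and the decomposition -/

section

open MvPolynomial

variable {d : ℕ}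

theorem exists_sphere_smul (hd : 1 ≤ d) (y : Vec d) :
    ∃ z : UnitSphere d, y = ‖y‖ • (z : Vec d) := by
  by_cases hy : y = 0
  · refine ⟨⟨EuclideanSpace.single ⟨0, hd⟩ 1, by simp⟩, by simp [hy]⟩
  · have hn : ‖y‖ ≠ 0 := norm_ne_zero_iff.2 hy
    refine ⟨⟨‖y‖⁻¹ • y, ?_⟩, ?_⟩
    · simp [norm_smul, hn]
    · simp [smul_smul, hn]

theorem eval_smul_of_isHomogeneous {l : ℕ} {p : MvPolynomial (Fin d) ℝ} (hp : p.IsHomogeneous l)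
    (c : ℝ) (y : Fin d → ℝ) : eval (c • y) p = c ^ l * eval y p := by
  obtain ⟨A, rfl⟩ := exists_tensorPoly_eq hp
  simp only [tensorPoly_apply, map_sum, map_mul, eval_C, map_prod, eval_X, Pi.smul_apply,
    smul_eq_mul, Finset.prod_mul_distrib, Finset.prod_const, Finset.card_univ, Fintype.card_fin,
    Finset.mul_sum]
  refine Finset.sum_congr rfl fun i _ => ?_
  ring

/-- Homogeneity propagates the vanishing from the sphere along rays. -/
theorem eq_zero_of_restrictSphere_eq_zero (hd : 1 ≤ d) {l : ℕ} {p : MvPolynomial (Fin d) ℝ}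
    (hp : p.IsHomogeneous l) (h : restrictSphere d p = 0) : p = 0 := by
  refine poly_ext fun y => ?_
  obtain ⟨z, hz⟩ := exists_sphere_smul hd y
  have h1 : (fun i => y i) = ‖y‖ • fun i => (z : Vec d) i := by
    funext i
    conv_lhs => rw [hz]
    rfl
  have h2 : eval (fun i => (z : Vec d) i) p = 0 := congrFun h z
  rw [h1, eval_smul_of_isHomogeneous hp, h2, mul_zero, map_zero]

theorem range_tensorPoly (d l : ℕ) :
    LinearMap.range (tensorPoly d l) = homogeneousSubmodule (Fin d) ℝ l := by
  refine le_antisymm ?_ fun p hp => ?_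
  · rintro _ ⟨A, rfl⟩
    exact tensorPoly_isHomogeneous A
  · obtain ⟨A, hA⟩ := exists_tensorPoly_eq ((mem_homogeneousSubmodule l p).1 hp)
    exact ⟨A, hA⟩

/-- Finite dimensionality makes `finrank` a true dimension rather than the default value 0. -/
instance finite_homogeneousSubmodule (l : ℕ) :
    FiniteDimensional ℝ (homogeneousSubmodule (Fin d) ℝ l) := by
  rw [← range_tensorPoly]
  infer_instance

instance finite_harmonic (l : ℕ) : FiniteDimensional ℝ
    (homogeneousSubmodule (Fin d) ℝ l ⊓ LinearMap.ker (polyLaplacian d) :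
      Submodule ℝ (MvPolynomial (Fin d) ℝ)) :=
  Submodule.finiteDimensional_inf_left _ _

instance finite_sphericalHarmonics (l : ℕ) : FiniteDimensional ℝ (sphericalHarmonics d l) := by
  unfold sphericalHarmonics
  infer_instance

theorem dimHarmonics_le (d l : ℕ) : dimHarmonics d l ≤ d ^ l := by
  calc dimHarmonics d l
    _ ≤ Module.finrank ℝ (homogeneousSubmodule (Fin d) ℝ l ⊓ LinearMap.ker (polyLaplacian d) :
        Submodule ℝ (MvPolynomial (Fin d) ℝ)) := Submodule.finrank_map_le _ _
    _ ≤ Module.finrank ℝ (homogeneousSubmodule (Fin d) ℝ l) :=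
      Submodule.finrank_mono inf_le_left
    _ ≤ Module.finrank ℝ (Tensor d l) := by
      rw [← range_tensorPoly]
      exact LinearMap.finrank_range_le _
    _ = d ^ l := by simp

/-- Squarefree monomials of degree l have degree at most one in each variable, so they are harmonic.
They are linearly independent, and remain so on the sphere because restriction is injective on
homogeneous polynomials. -/
theorem choose_le_dimHarmonics (hd : 1 ≤ d) (l : ℕ) : d.choose l ≤ dimHarmonics d l := by
  let e : Finset.powersetCard l (Finset.univ : Finset (Fin d)) → MvPolynomial (Fin d) ℝ :=
    fun S => ∏ i ∈ (S : Finset (Fin d)), X i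
  have hmon : ∀ S : Finset (Fin d), (∏ i ∈ S, X i : MvPolynomial (Fin d) ℝ) =
      monomial (∑ i ∈ S, Finsupp.single i 1) 1 := by
    intro S
    rw [monomial_sum_one]
    rfl
  have hinj : Function.Injective fun S : Finset.powersetCard l (Finset.univ : Finset (Fin d)) =>
      ∑ i ∈ (S : Finset (Fin d)), Finsupp.single i 1 := by
    intro S T h
    have hval : ∀ (S : Finset (Fin d)) (a : Fin d),
        (∑ i ∈ S, Finsupp.single i 1 : Fin d →₀ ℕ) a = if a ∈ S then 1 else 0 := by
      intro S a
      simp [Finsupp.finsetSum_apply, Finsupp.single_apply]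
    refine Subtype.ext (Finset.ext fun a => ?_)
    have h1 := DFunLike.congr_fun h a
    simp only [hval] at h1
    by_cases hS : a ∈ (S : Finset (Fin d)) <;> by_cases hT : a ∈ (T : Finset (Fin d)) <;>
      simp_all
  have hli : LinearIndependent ℝ e := by
    have h1 : e = basisMonomials (Fin d) ℝ ∘
        fun S : Finset.powersetCard l (Finset.univ : Finset (Fin d)) => ∑ i ∈ (S : Finset (Fin d)),
        Finsupp.single i 1 := by
      funext S
      simp [e, hmon, coe_basisMonomials]
    rw [h1]
    exact (basisMonomials (Fin d) ℝ).linearIndependent.comp _ hinj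
  have hharm : ∀ S, e S ∈ (homogeneousSubmodule (Fin d) ℝ l ⊓ LinearMap.ker (polyLaplacian d) :
      Submodule ℝ (MvPolynomial (Fin d) ℝ)) := by
    intro S
    refine ⟨?_, ?_⟩
    · have h := IsHomogeneous.prod (S : Finset (Fin d)) (fun i => X (R := ℝ) i) (fun _ => 1)
        fun i _ => isHomogeneous_X _ _
      simpa [(Finset.mem_powersetCard.1 S.2).2] using h
    · rw [SetLike.mem_coe, LinearMap.mem_ker, polyLaplacian_apply]
      refine Finset.sum_eq_zero fun i _ => ?_
      have h0 : ∀ T : Finset (Fin d), i ∉ T → pderiv i (∏ a ∈ T, X a : MvPolynomial (Fin d) ℝ) = 0 := by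
        intro T
        induction T using Finset.induction_on with
        | empty => intro _; simp
        | insert a T ha ih =>
          intro hi
          rw [Finset.mem_insert, not_or] at hi
          rw [Finset.prod_insert ha, Derivation.leibniz, ih hi.2, pderiv_X_of_ne (Ne.symm hi.1)]
          simp
      by_cases hi : i ∈ (S : Finset (Fin d))
      · simp only [e]
        rw [← Finset.mul_prod_erase _ _ hi, Derivation.leibniz, h0 _ (Finset.notMem_erase i _)]
        simp [h0 _ (Finset.notMem_erase i _)]
      · simp only [e]
        rw [h0 _ hi, map_zero]
  have hli2 : LinearIndependent ℝ fun S => (⟨restrictSphere d (e S),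
      Submodule.mem_map_of_mem (hharm S)⟩ : sphericalHarmonics d l) := by
    refine LinearIndependent.of_comp (sphericalHarmonics d l).subtype ?_
    refine LinearIndependent.map_injOn (v := e) hli (restrictSphere d) ?_
    intro p hp q hq hpq
    have hle : Submodule.span ℝ (Set.range e) ≤ homogeneousSubmodule (Fin d) ℝ l :=
      Submodule.span_le.2 (by rintro _ ⟨S, rfl⟩; exact (hharm S).1)
    refine sub_eq_zero.1 (eq_zero_of_restrictSphere_eq_zero hd
      ((mem_homogeneousSubmodule l _).1 (Submodule.sub_mem _ (hle hp) (hle hq))) ?_)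
    rw [map_sub, hpq, sub_self]
  have h := hli2.fintype_card_le_finrank
  simpa [dimHarmonics] using h

theorem kappa_pos (hd : 2 ≤ d) (l : ℕ) : 0 < kappa d l := by
  unfold kappa
  split_ifs with h
  · positivity
  · have h3 : (3 : ℝ) ≤ d := by exact_mod_cast (by omega : 3 ≤ d)
    have h1 := rising_pos (show (0 : ℝ) < (d : ℝ) / 2 - 1 by linarith) l
    have h2 := rising_pos (show (0 : ℝ) < (d : ℝ) - 2 by linarith) l
    positivity

theorem kappa_one_pos {l : ℕ} (hl : l ≤ 1) : 0 < kappa 1 l := by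
  interval_cases l <;> norm_num [kappa, rising_succ]

/-- If κ vanishes then d = 1 and l ≥ 2, where the trace of a tensor is its only entry. If N
vanishes, the harmonic polynomial of the projection is zero on the sphere, hence everywhere. -/
theorem tfProj_eq_zero_of_kappa_mul_eq_zero (hd : 1 ≤ d) {l : ℕ}
    (h : kappa d l * √(dimHarmonics d l : ℝ) = 0) (A : Tensor d l) : tfProj A = 0 := by
  have hmem := tfProj_mem A
  rcases mul_eq_zero.1 h with h | h
  · obtain rfl : d = 1 := by
      by_contra hne
      exact (kappa_pos (by omega) l).ne' h
    rcases l with _ | _ | l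
    · exact absurd h (kappa_one_pos (by omega)).ne'
    · exact absurd h (kappa_one_pos (by omega)).ne'
    · have htr := LinearMap.mem_ker.1 hmem.2
      ext i
      have h1 := congrArg (fun T : Tensor 1 l => T fun _ => 0) htr
      simp only [partialTrace, LinearMap.coe_mk, AddHom.coe_mk, Fin.sum_univ_one] at h1
      rw [Subsingleton.elim i (Fin.cons 0 (Fin.cons 0 fun _ => 0))]
      exact h1
  · have hN : dimHarmonics d l = 0 := by
      rw [Real.sqrt_eq_zero (Nat.cast_nonneg _)] at h
      exact_mod_cast h
    have hbot : sphericalHarmonics d l = ⊥ := Submodule.finrank_eq_zero.1 hN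
    have hr : restrictSphere d (tensorPoly d l (tfProj A)) ∈ sphericalHarmonics d l :=
      Submodule.mem_map_of_mem ⟨tensorPoly_isHomogeneous _,
        polyLaplacian_tensorPoly_of_mem_tracelessSym hmem⟩
    rw [hbot, Submodule.mem_bot] at hr
    have h0 := eq_zero_of_restrictSphere_eq_zero hd (tensorPoly_isHomogeneous _) hr
    refine symTensors_ext (tracelessSym_le_symTensors d l hmem) (Submodule.zero_mem _) ?_
    rw [h0, map_zero]

theorem hermiteBeta_smul_harmonicTensor (hd : 1 ≤ d) (k j : ℕ) (r : ℝ) (z : UnitSphere d) :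
    hermiteBeta d k j r • harmonicTensor d (k - 2 * j) z =
      (√(k ! : ℝ) * ∑ i ∈ Finset.range (j + 1),
        (-1) ^ i * r ^ (k - 2 * i) / (2 ^ i * (i ! : ℝ) * ((k - 2 * i)! : ℝ)) *
          fischerCoeff d (k - 2 * i) (j - i)) • tfProj (vecPow (z : Vec d) (k - 2 * j)) := by
  rw [harmonicTensor, smul_smul]
  by_cases h : kappa d (k - 2 * j) * √(dimHarmonics d (k - 2 * j) : ℝ) = 0
  · rw [tfProj_eq_zero_of_kappa_mul_eq_zero hd h, smul_zero, smul_zero]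
  · rw [hermiteBeta, mul_right_comm, div_mul_cancel₀ _ h]

/-- The Hermite-to-harmonic decomposition. -/
theorem hermiteTensor_eq_sum (hd : 1 ≤ d) (k : ℕ) (x : Vec d) (z : UnitSphere d)
    (hx : x = ‖x‖ • (z : Vec d)) :
    hermiteTensor d k x = ∑ j : Fin (k / 2 + 1), hermiteBeta d k (j : ℕ) ‖x‖ •
      symProj (castOrder (show k - 2 * (j : ℕ) + 2 * (j : ℕ) = k by omega)
        (tmul (harmonicTensor d (k - 2 * (j : ℕ)) z) (idPow d (j : ℕ)))) := by
  have hz : ‖(z : Vec d)‖ = 1 := by simp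
  refine symTensors_ext (hermiteTensor_mem_symTensors k x) (Submodule.sum_mem _ fun j _ =>
    Submodule.smul_mem _ _ (symProj_mem_symTensors _)) ?_
  set H : ℕ → MvPolynomial (Fin d) ℝ := fun n => tensorPoly d n (tfProj (vecPow (z : Vec d) n))
    with hH
  have hlin : linearPoly x = ‖x‖ • linearPoly (z : Vec d) := by
    rw [linearPoly, linearPoly, Finset.smul_sum]
    refine Finset.sum_congr rfl fun i _ => ?_
    rw [smul_eq_C_mul, ← mul_assoc, ← C_mul]
    congr 2
    conv_lhs => rw [hx]
    rfl
  have hterm : ∀ j : ℕ, ∀ h : k - 2 * j + 2 * j = k,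
      tensorPoly d k (hermiteBeta d k j ‖x‖ • symProj (castOrder h
        (tmul (harmonicTensor d (k - 2 * j) z) (idPow d j)))) =
      ∑ i ∈ Finset.range (j + 1), (√(k ! : ℝ) *
        ((-1) ^ i * ‖x‖ ^ (k - 2 * i) / (2 ^ i * (i ! : ℝ) * ((k - 2 * i)! : ℝ)) *
          fischerCoeff d (k - 2 * i) (j - i))) •
            (normSqPoly d ^ (i + (j - i)) * H (k - 2 * (i + (j - i)))) := by
    intro j h
    rw [map_smul, tensorPoly_symProj, tensorPoly_castOrder, tensorPoly_tmul, tensorPoly_idPow,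
      ← smul_mul_assoc, ← map_smul, hermiteBeta_smul_harmonicTensor hd, map_smul, Finset.mul_sum,
      smul_mul_assoc, Finset.sum_smul]
    refine Finset.sum_congr rfl fun i hi => ?_
    rw [show i + (j - i) = j by have := Finset.mem_range.1 hi; omega, mul_comm (tensorPoly d _ _)]
  -- The double sum over i ≤ j is reindexed by i and j - i: i is the Hermite index and j - i the
  -- Fischer index. This is why `hterm` writes j as i + (j - i).
  rw [map_sum, Finset.sum_congr rfl fun (j : Fin (k / 2 + 1)) _ => hterm j (by omega),
    Fin.sum_univ_eq_sum_range (fun j => ∑ i ∈ Finset.range (j + 1), (√(k ! : ℝ) *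
        ((-1) ^ i * ‖x‖ ^ (k - 2 * i) / (2 ^ i * (i ! : ℝ) * ((k - 2 * i)! : ℝ)) *
          fischerCoeff d (k - 2 * i) (j - i))) •
            (normSqPoly d ^ (i + (j - i)) * H (k - 2 * (i + (j - i))))) (k / 2 + 1),
    Finset.sum_range_diag_flip (k / 2 + 1) (fun i j => (√(k ! : ℝ) *
        ((-1) ^ i * ‖x‖ ^ (k - 2 * i) / (2 ^ i * (i ! : ℝ) * ((k - 2 * i)! : ℝ)) *
          fischerCoeff d (k - 2 * i) j)) • (normSqPoly d ^ (i + j) * H (k - 2 * (i + j)))),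
    tensorPoly_hermiteTensor]
  refine Finset.sum_congr rfl fun i hi => ?_
  have hik : 2 * i ≤ k := by have := Finset.mem_range.1 hi; omega
  rw [hlin, smul_pow, linearPoly_pow_eq hd hz, Finset.smul_sum, Finset.mul_sum, Finset.smul_sum,
    show (k - 2 * i) / 2 + 1 = k / 2 + 1 - i by omega]
  refine Finset.sum_congr rfl fun j _ => ?_
  rw [mul_smul_comm, mul_smul_comm, smul_smul, smul_smul, ← mul_assoc, ← pow_add,
    show k - 2 * (i + j) = k - 2 * i - 2 * j by omega, hermiteCoeff, if_pos hik]
  congr 1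
  have hs : (√(k ! : ℝ))⁻¹ * (k ! : ℝ) = √(k ! : ℝ) := by
    rw [inv_mul_eq_div, Real.div_sqrt]
  linear_combination ((-1) ^ i * ‖x‖ ^ (k - 2 * i) / (2 ^ i * (i ! : ℝ) * ((k - 2 * i)! : ℝ)) *
    fischerCoeff d (k - 2 * i) j) * hs

end

/-! ### Chu-Vandermonde and Laguerre integrals against the chi law -/

section

open MeasureTheory

variable {d : ℕ}

theorem rising_succ_left (a : ℝ) (n : ℕ) : rising a (n + 1) = a * rising (a + 1) n := by
  induction n with
  | zero => simp [rising_succ]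
  | succ n ih =>
    rw [rising_succ, ih, rising_succ]
    push_cast
    ring

theorem rising_add (a : ℝ) (m n : ℕ) : rising a (m + n) = rising a m * rising (a + m) n := by
  induction n with
  | zero => simp
  | succ n ih =>
    rw [← add_assoc, rising_succ, ih, rising_succ]
    push_cast
    ring

theorem rising_neg_of_lt {m j : ℕ} (h : m < j) : rising (-(m : ℝ)) j = 0 := by
  obtain ⟨n, rfl⟩ := Nat.exists_eq_add_of_lt h
  rw [show m + n + 1 = m + (1 + n) by ring, rising_add, rising_add (-(m : ℝ) + m)]
  simp [rising_succ]

theorem rising_neg_self (j : ℕ) : rising (-(j : ℝ)) j = (-1) ^ j * (j ! : ℝ) := by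
  induction j with
  | zero => simp
  | succ j ih =>
    rw [rising_succ_left, show -((j + 1 : ℕ) : ℝ) + 1 = -(j : ℝ) by push_cast; ring, ih,
      Nat.factorial_succ]
    push_cast
    ring

/-- The Chu-Vandermonde identity. -/
theorem sum_choose_mul_rising (j : ℕ) (a b : ℝ) :
    ∑ t ∈ Finset.range (j + 1), (-1) ^ t * (j.choose t : ℝ) * rising (a + t) (j - t) * rising b t =
      rising (a - b) j := by
  induction j generalizing a b with
  | zero => simp
  | succ j ih =>
    -- Pascal's rule splits the sum for j + 1 in two. In this half the last factor of (a+t)_{j+1-t}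
    -- is a + j, independent of t.
    have h1 : ∑ t ∈ Finset.range (j + 1),
        (-1) ^ t * (j.choose t : ℝ) * rising (a + t) (j + 1 - t) * rising b t =
          (a + j) * rising (a - b) j := by
      rw [← ih, Finset.mul_sum]
      refine Finset.sum_congr rfl fun t ht => ?_
      have ht' : t ≤ j := by have := Finset.mem_range.1 ht; omega
      rw [Nat.sub_add_comm ht', rising_succ, Nat.cast_sub ht']
      ring
    -- In the other half (b)_{t+1} = b (b+1)_t, and raising both a and b by one preserves a - b.
    have h2 : ∑ t ∈ Finset.range (j + 1),
        (-1) ^ t * (j.choose t : ℝ) * rising (a + (t + 1 : ℕ)) (j - t) * rising b (t + 1) =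
          b * rising (a - b) j := by
      rw [show a - b = a + 1 - (b + 1) by ring, ← ih, Finset.mul_sum]
      refine Finset.sum_congr rfl fun t _ => ?_
      rw [rising_succ_left, show a + ((t + 1 : ℕ) : ℝ) = a + 1 + t by push_cast; ring]
      ring
    have h3 : ∑ t ∈ Finset.range (j + 1),
        (-1) ^ t * (j.choose t : ℝ) * rising (a + t) (j + 1 - t) * rising b t =
        ∑ t ∈ Finset.range (j + 1), (-1) ^ (t + 1) * (j.choose (t + 1) : ℝ) *
          rising (a + (t + 1 : ℕ)) (j - t) * rising b (t + 1) + rising a (j + 1) := by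
      rw [Finset.sum_range_succ', Finset.sum_range_succ, Nat.choose_succ_self]
      simp
    rw [Finset.sum_range_succ', rising_succ,
      show rising (a - b) j * (a - b + j) =
        (a + j) * rising (a - b) j - b * rising (a - b) j by ring, ← h1, ← h2, h3,
      add_sub_right_comm, ← Finset.sum_sub_distrib]
    congr 1
    · refine Finset.sum_congr rfl fun t _ => ?_
      rw [Nat.choose_succ_succ, show j + 1 - (t + 1) = j - t by omega]
      push_cast
      ring
    · simp

/-- The moment of order `n` of the chi distribution with `d` degrees of freedom. -/
noncomputable def chiMoment (d n : ℕ) : ℝ :=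
  2 ^ ((n : ℝ) / 2) * Real.Gamma (((d : ℝ) + n) / 2) / Real.Gamma ((d : ℝ) / 2)

theorem chiMoment_pos (hd : 1 ≤ d) (n : ℕ) : 0 < chiMoment d n := by
  have h : (0 : ℝ) < d := by exact_mod_cast hd
  have h1 := Real.Gamma_pos_of_pos (show 0 < ((d : ℝ) + n) / 2 by positivity)
  have h2 := Real.Gamma_pos_of_pos (show 0 < (d : ℝ) / 2 by positivity)
  unfold chiMoment
  positivity

theorem chiMoment_zero (hd : 1 ≤ d) : chiMoment d 0 = 1 := by
  have h : (0 : ℝ) < d := by exact_mod_cast hd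
  have h2 := Real.Gamma_pos_of_pos (show 0 < (d : ℝ) / 2 by positivity)
  simp [chiMoment, h2.ne']

theorem chiMoment_add_two (hd : 1 ≤ d) (n : ℕ) :
    chiMoment d (n + 2) = ((d : ℝ) + n) * chiMoment d n := by
  have h : (0 : ℝ) < d := by exact_mod_cast hd
  unfold chiMoment
  rw [show ((d : ℝ) + (n + 2 : ℕ)) / 2 = ((d : ℝ) + n) / 2 + 1 by push_cast; ring,
    Real.Gamma_add_one (by positivity),
    show ((n + 2 : ℕ) : ℝ) / 2 = (n : ℝ) / 2 + 1 by push_cast; ring,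
    Real.rpow_add_one (by norm_num)]
  ring

theorem chiMoment_add_two_mul (hd : 1 ≤ d) (n t : ℕ) :
    chiMoment d (n + 2 * t) = 2 ^ t * rising (((d : ℝ) + n) / 2) t * chiMoment d n := by
  induction t with
  | zero => simp
  | succ t ih =>
    rw [show n + 2 * (t + 1) = n + 2 * t + 2 by ring, chiMoment_add_two hd, ih, rising_succ]
    push_cast
    ring

theorem chi_density_mul_pow (hd : 1 ≤ d) (n : ℕ) {r : ℝ} (hr : 0 < r) :
    (ENNReal.ofReal (2 ^ (1 - (d : ℝ) / 2) / Real.Gamma ((d : ℝ) / 2) * r ^ (d - 1) *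
      Real.exp (-(r ^ 2 / 2)))).toReal • r ^ n =
    2 ^ (1 - (d : ℝ) / 2) / Real.Gamma ((d : ℝ) / 2) *
      (r ^ ((d : ℝ) + n - 1) * Real.exp (-(1 / 2) * r ^ (2 : ℝ))) := by
  have h : (0 : ℝ) < d := by exact_mod_cast hd
  have h2 := Real.Gamma_pos_of_pos (show 0 < (d : ℝ) / 2 by positivity)
  rw [ENNReal.toReal_ofReal (by positivity), smul_eq_mul,
    show (d : ℝ) + n - 1 = ((d - 1 + n : ℕ) : ℝ) by push_cast [Nat.cast_sub hd]; ring,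
    Real.rpow_natCast, Real.rpow_two, pow_add, show -(1 / 2) * r ^ 2 = -(r ^ 2 / 2) by ring]
  ring

theorem measurable_chi_density (d : ℕ) : Measurable fun r : ℝ =>
    ENNReal.ofReal (2 ^ (1 - (d : ℝ) / 2) / Real.Gamma ((d : ℝ) / 2) * r ^ (d - 1) *
      Real.exp (-(r ^ 2 / 2))) := by
  fun_prop

theorem integrable_pow_chi (hd : 1 ≤ d) (n : ℕ) : Integrable (fun r => r ^ n) (chi d) := by
  have h : (1 : ℝ) ≤ d := by exact_mod_cast hd
  unfold chi
  rw [integrable_withDensity_iff_integrable_smul' (measurable_chi_density d)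
    (Filter.Eventually.of_forall fun _ => ENNReal.ofReal_lt_top)]
  refine (((integrableOn_rpow_mul_exp_neg_mul_rpow (p := 2) (s := (d : ℝ) + n - 1) (b := 1 / 2)
    (by have : (0 : ℝ) ≤ n := Nat.cast_nonneg n
        linarith) (by norm_num) (by norm_num)).integrable.const_mul
      (2 ^ (1 - (d : ℝ) / 2) / Real.Gamma ((d : ℝ) / 2))).congr ?_)
  filter_upwards [ae_restrict_mem measurableSet_Ioi] with r hr
  exact (chi_density_mul_pow hd n hr).symm

theorem integral_pow_chi (hd : 1 ≤ d) (n : ℕ) : ∫ r, r ^ n ∂(chi d) = chiMoment d n := by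
  have h : (1 : ℝ) ≤ d := by exact_mod_cast hd
  unfold chi
  rw [integral_withDensity_eq_integral_toReal_smul (measurable_chi_density d)
    (Filter.Eventually.of_forall fun _ => ENNReal.ofReal_lt_top),
    setIntegral_congr_fun measurableSet_Ioi fun r hr => chi_density_mul_pow hd n hr,
    integral_const_mul, integral_rpow_mul_exp_neg_mul_rpow (by norm_num)
      (by have : (0 : ℝ) ≤ n := Nat.cast_nonneg n
          linarith) (by norm_num), chiMoment, one_div, Real.inv_rpow (by norm_num),
    ← Real.rpow_neg (by norm_num), show ((d : ℝ) + n - 1 + 1) / 2 = ((d : ℝ) + n) / 2 by ring]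
  have h2 : (2 : ℝ) ^ ((n : ℝ) / 2) = 2 ^ (1 - (d : ℝ) / 2) *
      (2 ^ (-(-((d : ℝ) + n - 1 + 1) / 2)) * 2⁻¹) := by
    rw [← Real.rpow_neg_one, ← Real.rpow_add (by norm_num), ← Real.rpow_add (by norm_num)]
    congr 1
    ring
  rw [h2]
  ring

/-- The coefficients of `r ↦ L_j^{(α)}(r² / 2)`. -/
noncomputable def laguerreCoeff (j : ℕ) (α : ℝ) (t : ℕ) : ℝ :=
  (-1) ^ t * (rising (α + (t : ℝ) + 1) (j - t) / ((j - t)! : ℝ)) / (2 ^ t * (t ! : ℝ))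

theorem laguerre_eq_sum (j : ℕ) (α r : ℝ) :
    laguerre j α (r ^ 2 / 2) =
      ∑ t ∈ Finset.range (j + 1), laguerreCoeff j α t * r ^ (2 * t) := by
  refine Finset.sum_congr rfl fun t _ => ?_
  rw [laguerreCoeff, div_pow, ← pow_mul]
  ring

theorem pow_mul_laguerre_eq_sum (n j : ℕ) (α r : ℝ) :
    r ^ n * laguerre j α (r ^ 2 / 2) =
      ∑ t ∈ Finset.range (j + 1), laguerreCoeff j α t * r ^ (n + 2 * t) := by
  rw [laguerre_eq_sum, Finset.mul_sum]
  refine Finset.sum_congr rfl fun t _ => ?_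
  ring

theorem integrable_pow_mul_laguerre (hd : 1 ≤ d) (n j : ℕ) (α : ℝ) :
    Integrable (fun r => r ^ n * laguerre j α (r ^ 2 / 2)) (chi d) := by
  simp only [pow_mul_laguerre_eq_sum]
  exact integrable_finsetSum _ fun t _ => (integrable_pow_chi hd _).const_mul _

/-- The moment of order n + 2t is that of order n times 2^t ((d+n)/2)_t. The 2^t cancels against the
argument r²/2, leaving a Chu-Vandermonde sum with a = α + 1 and b = (d+n)/2. -/
theorem integral_pow_mul_laguerre (hd : 1 ≤ d) (n j : ℕ) (α : ℝ) :
    ∫ r, r ^ n * laguerre j α (r ^ 2 / 2) ∂(chi d) =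
      chiMoment d n * rising (α + 1 - ((d : ℝ) + n) / 2) j / (j ! : ℝ) := by
  simp only [pow_mul_laguerre_eq_sum]
  rw [integral_finsetSum _ fun t _ => (integrable_pow_chi hd _).const_mul _]
  simp only [integral_const_mul, integral_pow_chi hd, chiMoment_add_two_mul hd]
  rw [← sum_choose_mul_rising, Finset.mul_sum, Finset.sum_div]
  refine Finset.sum_congr rfl fun t ht => ?_
  rw [laguerreCoeff, Nat.cast_choose ℝ (by have := Finset.mem_range.1 ht; omega : t ≤ j),
    add_right_comm]
  have h1 : (j ! : ℝ) ≠ 0 := by positivity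
  have h2 : (t ! : ℝ) ≠ 0 := by positivity
  have h3 : ((j - t)! : ℝ) ≠ 0 := by positivity
  field_simp

/-- Only one Laguerre factor is expanded, so the integral with a single factor applies termwise. -/
theorem pow_mul_laguerre_sq (l j : ℕ) (α r : ℝ) :
    (r ^ l * laguerre j α (r ^ 2 / 2)) ^ 2 = ∑ m ∈ Finset.range (j + 1),
      laguerreCoeff j α m * (r ^ (2 * l + 2 * m) * laguerre j α (r ^ 2 / 2)) := by
  rw [mul_pow, sq (laguerre _ _ _)]
  nth_rewrite 1 [laguerre_eq_sum]
  rw [Finset.sum_mul, Finset.mul_sum]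
  refine Finset.sum_congr rfl fun m _ => ?_
  rw [pow_add, mul_comm 2 l, pow_mul r l 2]
  ring

theorem integrable_pow_mul_laguerre_sq (hd : 1 ≤ d) (l j : ℕ) (α : ℝ) :
    Integrable (fun r => (r ^ l * laguerre j α (r ^ 2 / 2)) ^ 2) (chi d) := by
  simp only [pow_mul_laguerre_sq]
  exact integrable_finsetSum _ fun m _ => (integrable_pow_mul_laguerre hd _ _ _).const_mul _

theorem integral_pow_mul_laguerre_sq (hd : 1 ≤ d) (l j : ℕ) :
    ∫ r, (r ^ l * laguerre j ((d : ℝ) / 2 + l - 1) (r ^ 2 / 2)) ^ 2 ∂(chi d) =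
      2 ^ l * rising ((d : ℝ) / 2) l * rising ((d : ℝ) / 2 + l) j / (j ! : ℝ) := by
  simp only [pow_mul_laguerre_sq]
  rw [integral_finsetSum _ fun m _ => (integrable_pow_mul_laguerre hd _ _ _).const_mul _]
  simp only [integral_const_mul, integral_pow_mul_laguerre hd]
  have h : ∀ m : ℕ, (d : ℝ) / 2 + l - 1 + 1 - ((d : ℝ) + (2 * l + 2 * m : ℕ)) / 2 = -(m : ℝ) := by
    intro m
    push_cast
    ring
  simp only [h]
  -- Orthogonality: (-m)_j = 0 for m < j, so only the leading coefficient m = j contributes.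
  rw [Finset.sum_range_succ, Finset.sum_eq_zero fun m hm => by
    rw [rising_neg_of_lt (Finset.mem_range.1 hm)]; simp, zero_add, rising_neg_self,
    chiMoment_add_two_mul hd, show 2 * l = 0 + 2 * l by ring, chiMoment_add_two_mul hd,
    chiMoment_zero hd, laguerreCoeff, Nat.sub_self, rising_zero,
    show ((d : ℝ) + (0 + 2 * l : ℕ)) / 2 = d / 2 + l by push_cast; ring,
    show ((d : ℝ) + (0 : ℕ)) / 2 = d / 2 by simp]
  have h1 : (j ! : ℝ) ≠ 0 := by positivity
  have h3 : ((-1 : ℝ) ^ j) * (-1) ^ j = 1 := by rw [← mul_pow]; simp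
  simp only [Nat.factorial_zero, Nat.cast_one, div_one, mul_one]
  field_simp
  rw [sq, h3, one_mul]

end

/-! ### Closed forms and ratios of the moments of β -/

section

open MeasureTheory

variable {d : ℕ}

theorem hermiteBeta_eq_laguerre (hd : 1 ≤ d) (l j : ℕ) (r : ℝ) :
    hermiteBeta d (l + 2 * j) j r =
      (-1) ^ j * √((l + 2 * j)! : ℝ) /
          (2 ^ j * kappa d l * √(dimHarmonics d l : ℝ) * (l ! : ℝ) *
            rising ((d : ℝ) / 2 + (l : ℝ)) j) *
          (r ^ l * laguerre j ((d : ℝ) / 2 + (l : ℝ) - 1) (r ^ 2 / 2)) := by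
  have h : (0 : ℝ) < d := by exact_mod_cast hd
  have hsum : ∑ i ∈ Finset.range (j + 1), (-1) ^ i * r ^ (l + 2 * j - 2 * i) /
      (2 ^ i * (i ! : ℝ) * ((l + 2 * j - 2 * i)! : ℝ)) *
        fischerCoeff d (l + 2 * j - 2 * i) (j - i) =
      (-1) ^ j / (2 ^ j * (l ! : ℝ) * rising ((d : ℝ) / 2 + (l : ℝ)) j) *
        (r ^ l * laguerre j ((d : ℝ) / 2 + (l : ℝ) - 1) (r ^ 2 / 2)) := by
    -- With i = j - t the power of r is l + 2t, as in the Laguerre sum. The Fischer denominator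
    -- (d/2+l)_t is what remains of (d/2+l)_j after the Laguerre numerator (d/2+l+t)_{j-t} cancels.
    rw [← Finset.sum_range_reflect, laguerre, Finset.mul_sum, Finset.mul_sum]
    refine Finset.sum_congr rfl fun t ht => ?_
    obtain ⟨s, rfl⟩ := Nat.exists_eq_add_of_le
      (show t ≤ j by have := Finset.mem_range.1 ht; omega)
    have h1 := rising_pos (show (0 : ℝ) < (d : ℝ) / 2 + l by positivity) t
    have h2 := rising_pos (show (0 : ℝ) < (d : ℝ) / 2 + l + t by positivity) s
    have h3 : (l ! : ℝ) ≠ 0 := by positivity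
    have h4 : (s ! : ℝ) ≠ 0 := by positivity
    have h5 : (t ! : ℝ) ≠ 0 := by positivity
    have h6 : ((l + 2 * t)! : ℝ) ≠ 0 := by positivity
    rw [show t + s + 1 - 1 - t = s by omega, show l + 2 * (t + s) - 2 * s = l + 2 * t by omega,
      show t + s - s = t by omega, show t + s - t = s by omega, fischerCoeff,
      show l + 2 * t - 2 * t = l by omega, rising_add,
      show (d : ℝ) / 2 + ((l + 2 * t : ℕ) : ℝ) - 2 * (t : ℝ) = d / 2 + l by push_cast; ring,
      show (d : ℝ) / 2 + l - 1 + t + 1 = d / 2 + l + t by ring]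
    generalize rising ((d : ℝ) / 2 + l) t = R1 at *
    generalize rising ((d : ℝ) / 2 + l + t) s = R2 at *
    rw [div_pow, ← pow_mul, pow_add, pow_add, pow_add, pow_mul]
    field_simp
    rw [show (2 : ℝ) ^ (2 * t) = 2 ^ t * 2 ^ t by rw [← pow_add]; congr 1; ring]
    ring_nf
    simp
  rw [hermiteBeta, show l + 2 * j - 2 * j = l by omega, hsum]
  ring

/-- The prefactor of the Laguerre polynomial in `hermiteBeta`. -/
noncomputable def betaFactor (d l j : ℕ) : ℝ :=
  (-1) ^ j * √((l + 2 * j)! : ℝ) / (2 ^ j * kappa d l * √(dimHarmonics d l : ℝ) * (l ! : ℝ) *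
    rising ((d : ℝ) / 2 + (l : ℝ)) j)

theorem integrable_hermiteBeta (hd : 1 ≤ d) (l j : ℕ) :
    Integrable (fun r => hermiteBeta d (l + 2 * j) j r) (chi d) := by
  simp only [hermiteBeta_eq_laguerre hd]
  exact (integrable_pow_mul_laguerre hd _ _ _).const_mul _

theorem integrable_hermiteBeta_sq (hd : 1 ≤ d) (l j : ℕ) :
    Integrable (fun r => hermiteBeta d (l + 2 * j) j r ^ 2) (chi d) := by
  simp only [hermiteBeta_eq_laguerre hd, mul_pow (_ / _)]
  exact (integrable_pow_mul_laguerre_sq hd _ _ _).const_mul _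

theorem betaMean_eq (hd : 1 ≤ d) (l j : ℕ) :
    betaMean d l j =
      betaFactor d l j * (chiMoment d l * rising ((l : ℝ) / 2) j / (j ! : ℝ)) := by
  simp only [betaMean, hermiteBeta_eq_laguerre hd]
  rw [integral_const_mul, integral_pow_mul_laguerre hd, betaFactor,
    show (d : ℝ) / 2 + l - 1 + 1 - ((d : ℝ) + l) / 2 = (l : ℝ) / 2 by ring]

theorem betaSecondMoment_eq (hd : 1 ≤ d) (l j : ℕ) :
    betaSecondMoment d l j = betaFactor d l j ^ 2 *
      (2 ^ l * rising ((d : ℝ) / 2) l * rising ((d : ℝ) / 2 + l) j / (j ! : ℝ)) := by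
  simp only [betaSecondMoment, hermiteBeta_eq_laguerre hd, mul_pow (_ / _)]
  rw [integral_const_mul, integral_pow_mul_laguerre_sq hd, betaFactor]

theorem betaMean_zero_left (hd : 1 ≤ d) {j : ℕ} (hj : 1 ≤ j) : betaMean d 0 j = 0 := by
  obtain ⟨j, rfl⟩ := Nat.exists_eq_add_of_le' hj
  rw [betaMean_eq hd, rising_succ_left]
  simp

theorem betaFactor_sq (d l j : ℕ) :
    betaFactor d l j ^ 2 = ((l + 2 * j)! : ℝ) / (4 ^ j * (l ! : ℝ) ^ 2) *
      (kappa d l ^ 2 * (dimHarmonics d l : ℝ) * rising ((d : ℝ) / 2 + l) j ^ 2)⁻¹ := by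
  have h7 : ((-1 : ℝ) ^ j) ^ 2 = 1 := by rw [← pow_mul, mul_comm, pow_mul]; simp
  rw [betaFactor, div_pow, mul_pow, h7, Real.sq_sqrt (Nat.cast_nonneg _)]
  simp only [mul_pow]
  rw [Real.sq_sqrt (Nat.cast_nonneg _), ← pow_mul, mul_comm j 2, pow_mul]
  norm_num
  ring

theorem dimHarmonics_pos (hd : 1 ≤ d) {l : ℕ} (hl : l ≤ d) : 0 < dimHarmonics d l :=
  (Nat.choose_pos hl).trans_le (choose_le_dimHarmonics hd l)

theorem betaFactor_sq_pos (hd : 2 ≤ d) {l : ℕ} (hl : l ≤ d) (j : ℕ) :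
    0 < betaFactor d l j ^ 2 := by
  have h : (0 : ℝ) < d := by exact_mod_cast (by omega : 0 < d)
  have h1 := kappa_pos hd l
  have h2 : (0 : ℝ) < dimHarmonics d l := by exact_mod_cast dimHarmonics_pos (by omega) hl
  have h3 := rising_pos (show (0 : ℝ) < (d : ℝ) / 2 + l by positivity) j
  rw [betaFactor_sq]
  positivity

theorem betaFactor_sq_succ (d l j : ℕ) :
    betaFactor d l (j + 1) ^ 2 = betaFactor d l j ^ 2 *
      (((l : ℝ) + 2 * j + 1) * (l + 2 * j + 2) / (4 * ((d : ℝ) / 2 + l + j) ^ 2)) := by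
  rw [betaFactor_sq, betaFactor_sq, rising_succ, show l + 2 * (j + 1) = l + 2 * j + 1 + 1 by ring,
    Nat.factorial_succ, Nat.factorial_succ, pow_succ]
  push_cast
  generalize (d : ℝ) / 2 + l + j = x
  simp only [mul_pow, mul_inv, div_eq_mul_inv]
  ring

/-- The terms in j² and lj cancel; the difference of the two sides is 2d + 4l - (l+1)(l+2) +
2j(d-1). -/
theorem factorial_ratio_le {l j : ℕ} (hd : (l + 1) * (l + 2) ≤ d) :
    ((l : ℝ) + 2 * j + 1) * (l + 2 * j + 2) ≤ 4 * ((d : ℝ) / 2 + l + j) * (j + 1) := by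
  have h : ((l : ℝ) + 1) * (l + 2) ≤ d := by exact_mod_cast hd
  have hl : (0 : ℝ) ≤ l := Nat.cast_nonneg l
  have hj : (0 : ℝ) ≤ j := Nat.cast_nonneg j
  have h2 : (1 : ℝ) ≤ d := by nlinarith
  nlinarith [mul_nonneg hj (sub_nonneg.2 h2)]

theorem betaSecondMoment_pos (hd : 2 ≤ d) {l : ℕ} (hl : l ≤ d) (j : ℕ) :
    0 < betaSecondMoment d l j := by
  have h : (0 : ℝ) < d := by exact_mod_cast (by omega : 0 < d)
  have h1 := betaFactor_sq_pos hd hl j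
  have h2 := rising_pos (show (0 : ℝ) < (d : ℝ) / 2 by positivity) l
  have h3 := rising_pos (show (0 : ℝ) < (d : ℝ) / 2 + l by positivity) j
  rw [betaSecondMoment_eq (by omega)]
  positivity

theorem betaMean_sq_pos (hd : 2 ≤ d) {l : ℕ} (hl : l ≤ d) (hl1 : 1 ≤ l) (j : ℕ) :
    0 < betaMean d l j ^ 2 := by
  have h : (0 : ℝ) < l := by exact_mod_cast hl1
  have h1 := betaFactor_sq_pos hd hl j
  have h2 := rising_pos (show (0 : ℝ) < (l : ℝ) / 2 by positivity) j
  have h3 := chiMoment_pos (show 1 ≤ d by omega) l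
  rw [betaMean_eq (by omega), mul_pow]
  positivity

theorem betaSecondMoment_succ (hd : 1 ≤ d) (l j : ℕ) :
    betaSecondMoment d l (j + 1) = betaSecondMoment d l j *
      (((l : ℝ) + 2 * j + 1) * (l + 2 * j + 2) / (4 * ((d : ℝ) / 2 + l + j) * (j + 1))) := by
  have h : (0 : ℝ) < d := by exact_mod_cast hd
  have h1 : (0 : ℝ) < (d : ℝ) / 2 + l + j := by positivity
  rw [betaSecondMoment_eq hd, betaSecondMoment_eq hd, betaFactor_sq_succ, rising_succ,
    Nat.factorial_succ]
  push_cast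
  generalize (d : ℝ) / 2 + l + j = x at *
  have h2 : (j ! : ℝ) ≠ 0 := by positivity
  have h3 : (j : ℝ) + 1 ≠ 0 := by positivity
  field_simp

theorem betaMean_sq_succ (hd : 1 ≤ d) (l j : ℕ) :
    betaMean d l (j + 1) ^ 2 = betaMean d l j ^ 2 *
      (((l : ℝ) + 2 * j + 1) * (l + 2 * j + 2) / (4 * ((d : ℝ) / 2 + l + j) * (j + 1)) *
        (((l : ℝ) / 2 + j) ^ 2 / (((d : ℝ) / 2 + l + j) * (j + 1)))) := by
  have h : (0 : ℝ) < d := by exact_mod_cast hd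
  have h1 : (0 : ℝ) < (d : ℝ) / 2 + l + j := by positivity
  rw [betaMean_eq hd, betaMean_eq hd, mul_pow, mul_pow, betaFactor_sq_succ, rising_succ,
    Nat.factorial_succ]
  push_cast
  generalize (d : ℝ) / 2 + l + j = x at *
  have h2 : (j ! : ℝ) ≠ 0 := by positivity
  have h3 : (j : ℝ) + 1 ≠ 0 := by positivity
  field_simp

theorem betaSecondMoment_ratio_le {l : ℕ} (hd : (l + 1) * (l + 2) ≤ d) (j : ℕ) :
    betaSecondMoment d l (j + 1) / betaSecondMoment d l j ≤ 1 := by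
  have hd2 : 2 ≤ d := by nlinarith
  have hl : l ≤ d := by nlinarith
  have h : (0 : ℝ) < d := by exact_mod_cast (by omega : 0 < d)
  rw [betaSecondMoment_succ (by omega), mul_div_cancel_left₀ _ (betaSecondMoment_pos hd2 hl j).ne']
  exact div_le_one_of_le₀ (factorial_ratio_le hd) (by positivity)

theorem betaMean_sq_ratio_le {l : ℕ} (hl1 : 1 ≤ l) (hd : (l + 1) * (l + 2) ≤ d) (j : ℕ) :
    betaMean d l (j + 1) ^ 2 / betaMean d l j ^ 2 ≤ 1 := by
  have hd2 : 2 ≤ d := by nlinarith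
  have hl : l ≤ d := by nlinarith
  have h : (0 : ℝ) < d := by exact_mod_cast (by omega : 0 < d)
  have h3 : ((l : ℝ) + 1) * (l + 2) ≤ d := by exact_mod_cast hd
  have h4 : (0 : ℝ) ≤ l := Nat.cast_nonneg l
  have h5 : (0 : ℝ) ≤ j := Nat.cast_nonneg j
  rw [betaMean_sq_succ (by omega), mul_div_cancel_left₀ _ (betaMean_sq_pos hd2 hl hl1 j).ne']
  refine mul_le_one₀ (div_le_one_of_le₀ (factorial_ratio_le hd) (by positivity)) (by positivity)
    (div_le_one_of_le₀ ?_ (by positivity))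
  nlinarith [mul_nonneg h4 h5, mul_nonneg h.le h5]

end

/-! ### Orders of magnitude as d → ∞ -/

section

open Filter Asymptotics

theorem isTheta_of_eventually_le {f g : ℕ → ℝ} {a b : ℝ} (ha : 0 < a)
    (hg : ∀ᶠ d in atTop, 0 ≤ g d) (h1 : ∀ᶠ d in atTop, a * g d ≤ f d)
    (h2 : ∀ᶠ d in atTop, f d ≤ b * g d) : f =Θ[atTop] g := by
  refine ⟨IsBigO.of_bound b ?_, IsBigO.of_bound a⁻¹ ?_⟩
  · filter_upwards [hg, h1, h2] with d h h' h''
    rw [Real.norm_of_nonneg h, Real.norm_of_nonneg ((mul_nonneg ha.le h).trans h')]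
    exact h''
  · filter_upwards [hg, h1] with d h h'
    rw [Real.norm_of_nonneg h, Real.norm_of_nonneg ((mul_nonneg ha.le h).trans h')]
    rwa [le_inv_mul_iff₀ ha]

theorem isTheta_half_add {c : ℝ} (hc : 0 ≤ c) :
    (fun d : ℕ => (d : ℝ) / 2 + c) =Θ[atTop] (fun d : ℕ => (d : ℝ)) := by
  refine isTheta_of_eventually_le (a := 1 / 2) (b := 1 / 2 + c) (by norm_num)
    (Eventually.of_forall fun d => Nat.cast_nonneg d)
    (Eventually.of_forall fun d => by linarith) ?_
  filter_upwards [eventually_ge_atTop 1] with d hd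
  have h : (1 : ℝ) ≤ d := by exact_mod_cast hd
  nlinarith

theorem isTheta_rising {c : ℝ} (hc : 0 ≤ c) (n : ℕ) :
    (fun d : ℕ => rising ((d : ℝ) / 2 + c) n) =Θ[atTop] (fun d : ℕ => (d : ℝ) ^ n) := by
  induction n with
  | zero => simp
  | succ n ih =>
    simp only [rising_succ, pow_succ, add_assoc]
    exact ih.mul (isTheta_half_add (by positivity))

theorem isTheta_dimHarmonics (l : ℕ) :
    (fun d : ℕ => (dimHarmonics d l : ℝ)) =Θ[atTop] (fun d : ℕ => (d : ℝ) ^ l) := by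
  refine ⟨IsBigO.of_bound 1 (Eventually.of_forall fun d => ?_),
    (isTheta_choose l).isBigO_symm.trans (IsBigO.of_bound 1 ?_)⟩
  · rw [Real.norm_of_nonneg (by positivity), Real.norm_of_nonneg (by positivity), one_mul]
    exact_mod_cast dimHarmonics_le d l
  · filter_upwards [eventually_ge_atTop 1] with d hd
    rw [Real.norm_of_nonneg (by positivity), Real.norm_of_nonneg (by positivity), one_mul]
    exact_mod_cast choose_le_dimHarmonics hd l

theorem rising_le_rising {a b : ℝ} (ha : 0 ≤ a) (hab : a ≤ b) (n : ℕ) :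
    rising a n ≤ rising b n := by
  have h : ∀ m, 0 ≤ rising a m := fun m => by
    induction m with
    | zero => simp
    | succ m ih => rw [rising_succ]; positivity
  induction n with
  | zero => simp
  | succ n ih =>
    rw [rising_succ, rising_succ]
    exact mul_le_mul ih (by linarith) (by positivity) ((h n).trans ih)

theorem rising_le_two_pow_mul {a : ℝ} (ha : 0 ≤ a) (n : ℕ) :
    rising (2 * a) n ≤ 2 ^ n * rising a n := by
  have h : ∀ b : ℝ, 0 ≤ b → ∀ m, 0 ≤ rising b m := fun b hb m => by
    induction m with
    | zero => simp
    | succ m ih => rw [rising_succ]; positivity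
  induction n with
  | zero => simp
  | succ n ih =>
    rw [rising_succ, rising_succ, show 2 ^ (n + 1) * (rising a n * (a + n)) =
      2 ^ n * rising a n * (2 * a + 2 * n) by ring]
    have hn : (0 : ℝ) ≤ n := Nat.cast_nonneg n
    exact mul_le_mul ih (by linarith) (by positivity) (by have := h a ha n; positivity)

theorem isTheta_kappa_sq (l : ℕ) :
    (fun d : ℕ => kappa d l ^ 2) =Θ[atTop] (fun _ : ℕ => (1 : ℝ)) := by
  -- With a = d/2 - 1, compare factor by factor: a + i ≤ 2a + i ≤ 2(a + i).
  have key : ∀ d : ℕ, 3 ≤ d → 1 ≤ kappa d l ^ 2 ∧ kappa d l ^ 2 ≤ 2 ^ l := by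
    intro d hd
    have h3 : (3 : ℝ) ≤ d := by exact_mod_cast hd
    have h1 := rising_pos (show (0 : ℝ) < (d : ℝ) / 2 - 1 by linarith) l
    have h2 := rising_pos (show (0 : ℝ) < (d : ℝ) - 2 by linarith) l
    rw [kappa, if_neg (by omega), Real.sq_sqrt (by positivity)]
    constructor
    · rw [le_div_iff₀ h2, one_mul]
      have h := rising_le_two_pow_mul (show (0 : ℝ) ≤ (d : ℝ) / 2 - 1 by linarith) l
      rwa [show 2 * ((d : ℝ) / 2 - 1) = d - 2 by ring] at h
    · rw [div_le_iff₀ h2]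
      exact mul_le_mul_of_nonneg_left
        (rising_le_rising (by linarith) (by linarith) l) (by positivity)
  refine isTheta_of_eventually_le (a := 1) (b := 2 ^ l) one_pos
    (Eventually.of_forall fun _ => zero_le_one) ?_ ?_
  · filter_upwards [eventually_ge_atTop 3] with d hd
    simpa using (key d hd).1
  · filter_upwards [eventually_ge_atTop 3] with d hd
    simpa using (key d hd).2

/-- The variance of r is nonnegative and its second moment is d. -/
theorem chiMoment_one_sq_le {d : ℕ} (hd : 1 ≤ d) : chiMoment d 1 ^ 2 ≤ d := by
  have hint : MeasureTheory.Integrable (fun r : ℝ => r ^ 2 + chiMoment d 1 ^ 2 * r ^ 0) (chi d) :=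
    (integrable_pow_chi hd 2).add ((integrable_pow_chi hd 0).const_mul _)
  have h : 0 ≤ ∫ r, (r - chiMoment d 1) ^ 2 ∂(chi d) :=
    MeasureTheory.integral_nonneg fun r => sq_nonneg _
  have e : ∀ r : ℝ, (r - chiMoment d 1) ^ 2 =
      (r ^ 2 + chiMoment d 1 ^ 2 * r ^ 0) - 2 * chiMoment d 1 * r ^ 1 := fun r => by ring
  simp only [e] at h
  rw [MeasureTheory.integral_sub hint ((integrable_pow_chi hd 1).const_mul _),
    MeasureTheory.integral_add (integrable_pow_chi hd 2) ((integrable_pow_chi hd 0).const_mul _),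
    MeasureTheory.integral_const_mul, MeasureTheory.integral_const_mul, integral_pow_chi hd,
    integral_pow_chi hd, integral_pow_chi hd, chiMoment_add_two hd 0, chiMoment_zero hd] at h
  push_cast at h
  linarith

theorem chiMoment_one_mul {d : ℕ} (hd : 1 ≤ d) : chiMoment d 1 * chiMoment (d + 1) 1 = d := by
  have h : (0 : ℝ) < d := by exact_mod_cast hd
  have h1 := (Real.Gamma_pos_of_pos (show 0 < (d : ℝ) / 2 by positivity)).ne'
  have h2 := (Real.Gamma_pos_of_pos (show 0 < ((d : ℝ) + 1) / 2 by positivity)).ne'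
  have h3 : (2 : ℝ) ^ ((1 : ℝ) / 2) * 2 ^ ((1 : ℝ) / 2) = 2 := by
    rw [← Real.rpow_add (by norm_num)]
    norm_num
  unfold chiMoment
  push_cast
  rw [show ((d : ℝ) + 1 + 1) / 2 = d / 2 + 1 by ring, Real.Gamma_add_one (by positivity)]
  field_simp
  rw [sq, h3]

/-- The means in dimensions d and d + 1 have product d, so the upper bound for d + 1 gives the lower
bound d²/(d+1) ≥ d/2 for d, without Gamma asymptotics. -/
theorem half_le_chiMoment_one_sq {d : ℕ} (hd : 1 ≤ d) : 1 / 2 * (d : ℝ) ≤ chiMoment d 1 ^ 2 := by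
  have h : (1 : ℝ) ≤ d := by exact_mod_cast hd
  have h1 := chiMoment_one_sq_le (show 1 ≤ d + 1 by omega)
  have h2 := chiMoment_one_mul hd
  have h3 : (d : ℝ) ^ 2 ≤ chiMoment d 1 ^ 2 * (d + 1) := by
    rw [← h2, mul_pow, h2]
    push_cast at h1
    exact mul_le_mul_of_nonneg_left h1 (sq_nonneg _)
  nlinarith [sq_nonneg (chiMoment d 1)]

/-- The two-step recurrence adds d + l to the product at each stage; only the odd orders need an
estimate of a Gamma quotient, at order one. -/
theorem isTheta_chiMoment_sq (l : ℕ) :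
    (fun d : ℕ => chiMoment d l ^ 2) =Θ[atTop] (fun d : ℕ => (d : ℝ) ^ l) := by
  induction l using Nat.twoStepInduction with
  | zero =>
    refine EventuallyEq.isTheta ?_
    filter_upwards [eventually_ge_atTop 1] with d hd
    rw [chiMoment_zero hd]
    norm_num
  | one =>
    refine isTheta_of_eventually_le (a := 1 / 2) (b := 1) (by norm_num)
      (Eventually.of_forall fun d => by positivity) ?_ ?_
    · filter_upwards [eventually_ge_atTop 1] with d hd
      simpa using half_le_chiMoment_one_sq hd
    · filter_upwards [eventually_ge_atTop 1] with d hd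
      simpa using chiMoment_one_sq_le hd
  | more l ih _ =>
    have h : (fun d : ℕ => chiMoment d (l + 2) ^ 2) =ᶠ[atTop]
        fun d : ℕ => 4 * ((d : ℝ) / 2 + (l : ℝ) / 2) ^ 2 * chiMoment d l ^ 2 := by
      filter_upwards [eventually_ge_atTop 1] with d hd
      rw [chiMoment_add_two hd]
      ring
    refine h.isTheta.trans ?_
    simp only [pow_add, mul_comm (_ ^ l)]
    exact (((isTheta_half_add (by positivity)).pow 2).const_mul_left four_ne_zero).mul ih

theorem isTheta_betaFactor_sq (l j : ℕ) :
    (fun d : ℕ => betaFactor d l j ^ 2) =Θ[atTop]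
      (fun d : ℕ => ((d : ℝ) ^ l * ((d : ℝ) ^ j) ^ 2)⁻¹) := by
  simp only [betaFactor_sq]
  refine IsTheta.const_mul_left (by positivity) ?_
  have h := (((isTheta_kappa_sq l).mul (isTheta_dimHarmonics l)).mul
    ((isTheta_rising (Nat.cast_nonneg l) j).pow 2)).inv
  simpa using h

theorem isTheta_betaMean_sq {l j : ℕ} (h : 1 ≤ l ∨ j = 0) :
    (fun d : ℕ => betaMean d l j ^ 2) =Θ[atTop] (fun d : ℕ => (d : ℝ) ^ (-(2 * (j : ℤ)))) := by
  have hc : (rising ((l : ℝ) / 2) j / (j ! : ℝ)) ^ 2 ≠ 0 := by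
    refine pow_ne_zero _ (div_ne_zero ?_ (by positivity))
    rcases h with h | rfl
    · have : (0 : ℝ) < l := by exact_mod_cast h
      exact (rising_pos (by positivity) j).ne'
    · simp
  have h1 : (fun d : ℕ => betaMean d l j ^ 2) =ᶠ[atTop] fun d : ℕ =>
      (rising ((l : ℝ) / 2) j / (j ! : ℝ)) ^ 2 * (betaFactor d l j ^ 2 * chiMoment d l ^ 2) := by
    filter_upwards [eventually_ge_atTop 1] with d hd
    rw [betaMean_eq hd]
    ring
  refine h1.isTheta.trans (IsTheta.const_mul_left hc
    (((isTheta_betaFactor_sq l j).mul (isTheta_chiMoment_sq l)).trans (EventuallyEq.isTheta ?_)))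
  filter_upwards [eventually_ge_atTop 1] with d hd
  have hd' : (d : ℝ) ≠ 0 := by exact_mod_cast (by omega : d ≠ 0)
  rw [zpow_neg, mul_comm 2, zpow_mul, zpow_natCast, zpow_ofNat]
  field_simp

theorem isTheta_betaSecondMoment (l j : ℕ) :
    (fun d : ℕ => betaSecondMoment d l j) =Θ[atTop] (fun d : ℕ => (d : ℝ) ^ (-(j : ℤ))) := by
  have h1 : (fun d : ℕ => betaSecondMoment d l j) =ᶠ[atTop] fun d : ℕ =>
      (2 ^ l / (j ! : ℝ)) * (betaFactor d l j ^ 2 *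
        (rising ((d : ℝ) / 2 + 0) l * rising ((d : ℝ) / 2 + l) j)) := by
    filter_upwards [eventually_ge_atTop 1] with d hd
    rw [betaSecondMoment_eq hd, add_zero]
    ring
  refine h1.isTheta.trans (IsTheta.const_mul_left (by positivity)
    (((isTheta_betaFactor_sq l j).mul ((isTheta_rising le_rfl l).mul
      (isTheta_rising (Nat.cast_nonneg l) j))).trans (EventuallyEq.isTheta ?_)))
  filter_upwards [eventually_ge_atTop 1] with d hd
  have hd' : (d : ℝ) ≠ 0 := by exact_mod_cast (by omega : d ≠ 0)
  rw [zpow_neg, zpow_natCast]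
  field_simp

end

end HermiteHarmonic

theorem mainTheorem9 :
    -- the decomposition, for every `x = r z` with `r = ‖x‖` and `‖z‖ = 1`
    (∀ d k : ℕ, 1 ≤ d → ∀ (x : HermiteHarmonic.Vec d) (z : HermiteHarmonic.UnitSphere d),
      x = ‖x‖ • (z : HermiteHarmonic.Vec d) →
      HermiteHarmonic.hermiteTensor d k x =
        ∑ j : Fin (k / 2 + 1),
          HermiteHarmonic.hermiteBeta d k (j : ℕ) ‖x‖ •
            HermiteHarmonic.symProj
              (HermiteHarmonic.castOrder (show k - 2 * (j : ℕ) + 2 * (j : ℕ) = k by omega)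
                (HermiteHarmonic.tmul
                  (HermiteHarmonic.harmonicTensor d (k - 2 * (j : ℕ)) z)
                  (HermiteHarmonic.idPow d (j : ℕ))))) ∧
    -- the coefficients through Laguerre polynomials
    (∀ d l j : ℕ, 1 ≤ d → ∀ r : ℝ,
      HermiteHarmonic.hermiteBeta d (l + 2 * j) j r =
        (-1) ^ j * √((Nat.factorial (l + 2 * j) : ℕ) : ℝ) /
          (2 ^ j * HermiteHarmonic.kappa d l * √(HermiteHarmonic.dimHarmonics d l : ℝ) *
            (Nat.factorial l : ℝ) * HermiteHarmonic.rising ((d : ℝ) / 2 + (l : ℝ)) j) *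
          (r ^ l * HermiteHarmonic.laguerre j ((d : ℝ) / 2 + (l : ℝ) - 1) (r ^ 2 / 2))) ∧
    -- both moments are finite
    (∀ d l j : ℕ, 1 ≤ d →
      MeasureTheory.Integrable (fun r => HermiteHarmonic.hermiteBeta d (l + 2 * j) j r)
        (HermiteHarmonic.chi d) ∧
      MeasureTheory.Integrable (fun r => HermiteHarmonic.hermiteBeta d (l + 2 * j) j r ^ 2)
        (HermiteHarmonic.chi d)) ∧
    -- orders of magnitude as `d → ∞`, for fixed `l` and `j`
    (∀ l j : ℕ, (1 ≤ l ∨ j = 0) →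
      Asymptotics.IsTheta Filter.atTop
        (fun d : ℕ => HermiteHarmonic.betaMean d l j ^ 2)
        (fun d : ℕ => (d : ℝ) ^ (-(2 * (j : ℤ))))) ∧
    (∀ d j : ℕ, 1 ≤ d → 1 ≤ j → HermiteHarmonic.betaMean d 0 j = 0) ∧
    (∀ l j : ℕ,
      Asymptotics.IsTheta Filter.atTop
        (fun d : ℕ => HermiteHarmonic.betaSecondMoment d l j)
        (fun d : ℕ => (d : ℝ) ^ (-(j : ℤ)))) ∧
    -- ratios of consecutive moments
    (∀ l : ℕ, ∃ C : ℕ, 0 < C ∧ ∀ d j : ℕ, C ≤ d → C ≤ j →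
      (1 ≤ l →
        0 < HermiteHarmonic.betaMean d l j ^ 2 ∧
        HermiteHarmonic.betaMean d l (j + 1) ^ 2 / HermiteHarmonic.betaMean d l j ^ 2 ≤ 1) ∧
      0 < HermiteHarmonic.betaSecondMoment d l j ∧
      HermiteHarmonic.betaSecondMoment d l (j + 1) / HermiteHarmonic.betaSecondMoment d l j
        ≤ 1) := by
  refine ⟨fun d k hd x z hx => HermiteHarmonic.hermiteTensor_eq_sum hd k x z hx,
    fun d l j hd r => HermiteHarmonic.hermiteBeta_eq_laguerre hd l j r,
    fun d l j hd => ⟨HermiteHarmonic.integrable_hermiteBeta hd l j,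
      HermiteHarmonic.integrable_hermiteBeta_sq hd l j⟩,
    fun l j h => HermiteHarmonic.isTheta_betaMean_sq h,
    fun d j hd hj => HermiteHarmonic.betaMean_zero_left hd hj,
    fun l j => HermiteHarmonic.isTheta_betaSecondMoment l j,
    -- This constant gives d ≥ 2, so that κ > 0, and l ≤ d, so that N ≥ binom(d, l) > 0; it is also
    -- the bound required by `factorial_ratio_le`.
    fun l => ⟨(l + 1) * (l + 2), by positivity, fun d j hd _ => ?_⟩⟩
  have hd2 : 2 ≤ d := by nlinarith
  have hl : l ≤ d := by nlinarith
  exact ⟨fun hl1 => ⟨HermiteHarmonic.betaMean_sq_pos hd2 hl hl1 j,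
      HermiteHarmonic.betaMean_sq_ratio_le hl1 hd j⟩,
    HermiteHarmonic.betaSecondMoment_pos hd2 hl j,
    HermiteHarmonic.betaSecondMoment_ratio_le hd j⟩
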